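/- Let $\Phi=\{x_1,x_2,\dots\}$ be a homogeneous Poisson point process of intensity $\Lambda>0$ on $\mathbb{R}^2$, with points listed by increasing distance to the origin; the points are interferers that do not move ($\Phi_t=\Phi$ for all $t$). Let $(F_j(t))_{t\in\mathbb{R}}$, $j=0,1,2,\dots$, be fading processes with values in $[0,\infty)$ and continuous paths, each stationary and strongly mixing, mutually independent and independent of $\Phi$; the variables $F_j(0)$, $j\ge 1$, have the same law, and it is not the point mass at $0$. Let $l:(0,\infty)\to[0,\infty)$ be a measurable path-loss function that is not almost everywhere zero, let $R>0$ and $\gamma\ge 0$, and put $$\mathrm{SINR}(t)=\frac{l(R)F_0(t)}{\sum_{j\ge1} l(|x_j|)F_j(t)+\gamma}\in[0,\infty],$$ with the convention $0/0=0$. Let $s(t)=g(\mathrm{SINR}(t))$ be the service rate, where $g:[0,\infty]\to[0,\infty]$ is measurable, $g(0)=0$, $g(x)\to0$ as $x\to0$, and $g\le h$ for some nondecreasing $h$ with $\mathbb{E}[h(\mathrm{SINR}(0))]<\infty$. (If $g$ is nondecreasing, the last condition just says that $s$ is integrable.) Let $\delta>0$ be the slot length, let $V(n)=\int_{n\delta}^{(n+1)\delta}s(t)\,dt$,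 and let $(A(n))_{n\in\mathbb{Z}}$ be a stationary ergodic sequence of arrivals in $[0,\infty)$, independent of $\Phi$ and of the fading, with rate $\lambda=\mathbb{E}[A(0)]\in(0,\infty)$. The workload of the queue satisfies $W_{n+1}=(W_n+A(n)-V(n))^+$; its stationary workload at time $n$ is the increasing limit, in $[0,\infty]$, as $m\to\infty$, of the workload at time $n$ of the queue that is empty at time $n-m$. Let $\Omega_U=\{\lambda>\delta\,\mathbb{E}[s(0)\mid\Phi]\}$. Then, for every arrival rate $\lambda\in(0,\infty)$, $\mathbb{P}(\Omega_U)>0$, and almost surely on $\Omega_U$ the stationary workload is infinite at all times $n\in\mathbb{Z}$. In particular, the stationary workload is infinite at all times with positive probability. -/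

import Mathlib

open MeasureTheory ProbabilityTheory Filter Topology
open scoped NNReal ENNReal

namespace StaticField

noncomputable section

/-- The plane `ℝ²` with its Euclidean norm. -/
abbrev Plane : Type := EuclideanSpace ℝ (Fin 2)

/-- The counting measure `∑ j, δ_{x j}` of a sequence of points of the plane. -/
def countingMeasure (x : ℕ → Plane) : Measure Plane :=
  Measure.sum fun j => Measure.dirac (x j)

/-- `Φ` is a Poisson point process with intensity measure `μ`: the number of points in a bounded
Borel set `B` is Poisson with mean `μ B`, and the numbers of points in disjoint bounded Borel sets
are independent. -/
structure IsPoissonProcess {Ω : Type*} [MeasurableSpace Ω] (P : Measure Ω)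
    (Φ : Ω → Measure Plane) (μ : Measure Plane) : Prop where
  measurable : Measurable Φ
  law : ∀ B : Set Plane, MeasurableSet B → Bornology.IsBounded B →
    P.map (fun ω => Φ ω B) =
      (poissonMeasure (μ B).toNNReal).map (Nat.cast : ℕ → ℝ≥0∞)
  indep : ∀ (n : ℕ) (B : Fin n → Set Plane), (∀ i, MeasurableSet (B i)) →
    (∀ i, Bornology.IsBounded (B i)) → Pairwise (fun i k => Disjoint (B i) (B k)) →
    iIndepFun (fun i ω => Φ ω (B i)) P

/-- A continuous-time process is stationary if all its time shifts have the same law. -/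
def IsStationary {Ω : Type*} [MeasurableSpace Ω] (P : Measure Ω) (Y : ℝ → Ω → ℝ≥0) : Prop :=
  ∀ τ : ℝ, P.map (fun ω t => Y (t + τ) ω) = P.map (fun ω t => Y t ω)

/-- The strong mixing coefficient `α(𝒜, ℬ) = sup |P(A ∩ B) - P(A) P(B)|` of two σ-algebras. -/
def mixingCoeff {Ω : Type*} [MeasurableSpace Ω] (P : Measure Ω) (𝒜 ℬ : MeasurableSpace Ω) : ℝ :=
  sSup {r : ℝ | ∃ A B : Set Ω, MeasurableSet[𝒜] A ∧ MeasurableSet[ℬ] B ∧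
    r = |P.real (A ∩ B) - P.real A * P.real B|}

/-- The σ-algebra generated by the values of the process `Y` at the times in `T`. -/
@[reducible] def sigmaOn {Ω : Type*} (Y : ℝ → Ω → ℝ≥0) (T : Set ℝ) : MeasurableSpace Ω :=
  ⨆ t ∈ T, MeasurableSpace.comap (Y t) inferInstance

/-- Strong mixing of a stationary process: `α(σ(Y_t, t ≤ 0), σ(Y_t, t ≥ τ)) → 0` as `τ → ∞`. -/
def IsStronglyMixing {Ω : Type*} [MeasurableSpace Ω] (P : Measure Ω) (Y : ℝ → Ω → ℝ≥0) : Prop :=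
  Tendsto (fun τ : ℝ => mixingCoeff P (sigmaOn Y (Set.Iic 0)) (sigmaOn Y (Set.Ici τ)))
    atTop (𝓝 0)

/-- A sequence indexed by `ℤ` is stationary and ergodic: the shift is measure preserving and
ergodic for its law. -/
def IsStationaryErgodic {Ω : Type*} [MeasurableSpace Ω] (P : Measure Ω) (A : ℤ → Ω → ℝ≥0) :
    Prop :=
  Ergodic (fun (a : ℤ → ℝ≥0) (n : ℤ) => a (n + 1)) (P.map fun ω n => A n ω)

/-- Interference at the origin, when the `j`-th interferer is at `x j` and has fading
`f (j + 1)` towards the origin. -/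
def interference (l : ℝ → ℝ≥0) (x : ℕ → Plane) (f : ℕ → ℝ≥0) : ℝ≥0∞ :=
  ∑' j : ℕ, (l ‖x j‖ : ℝ≥0∞) * f (j + 1)

/-- The SINR `l(R) f₀ / (I + γ)` at the origin, as an element of `[0, ∞]`; here `f 0` is the fading
of the useful signal, sent from distance `R`. -/
def sinr (l : ℝ → ℝ≥0) (R : ℝ) (γ : ℝ≥0) (x : ℕ → Plane) (f : ℕ → ℝ≥0) : ℝ≥0∞ :=
  ((l R : ℝ≥0∞) * f 0) / (interference l x f + γ)

/-- The service rate `s(t) = g(SINR(t))` in a static field: the interferers stay at the points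
`X j ω` for all times, and only the fading depends on `t`. -/
def serviceRate {Ω : Type*} (g : ℝ≥0∞ → ℝ≥0∞) (l : ℝ → ℝ≥0) (R : ℝ) (γ : ℝ≥0)
    (X : ℕ → Ω → Plane) (F : ℕ → ℝ → Ω → ℝ≥0) (t : ℝ) (ω : Ω) : ℝ≥0∞ :=
  g (sinr l R γ (fun j => X j ω) (fun j => F j t ω))

/-- The service `V(n)` offered in the time slot `(nδ, (n+1)δ]`. -/
def slotService {Ω : Type*} (δ : ℝ) (s : ℝ → Ω → ℝ≥0∞) (n : ℤ) (ω : Ω) : ℝ≥0∞ :=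
  ∫⁻ t in Set.Ioc (n * δ) ((n + 1) * δ), s t ω

/-- `workloadFrom a v n m` is the workload at time `n` of the queue with arrivals `a` and services
`v` that is empty at time `n - m` and then follows the Lindley recursion
`w (k + 1) = (w k + a k - v k)⁺` (subtraction in `[0, ∞]` is truncated at `0`). -/
def workloadFrom (a v : ℤ → ℝ≥0∞) : ℤ → ℕ → ℝ≥0∞
  | _, 0 => 0
  | n, m + 1 => workloadFrom a v (n - 1) m + a (n - 1) - v (n - 1)

/-- The stationary workload at time `n` (Loynes' construction): the limit, which is a supremum, of
the workloads at time `n` of the queues started empty at time `n - m`, as `m → ∞`. -/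
def stationaryWorkload (a v : ℤ → ℝ≥0∞) (n : ℤ) : ℝ≥0∞ :=
  ⨆ m : ℕ, workloadFrom a v n m

/-- The workload started empty in the past grows with the age of the queue, so the supremum in
`stationaryWorkload` is a limit. -/
theorem workloadFrom_mono (a v : ℤ → ℝ≥0∞) (n : ℤ) : Monotone (workloadFrom a v n) := by
  refine monotone_nat_of_le_succ fun m => ?_
  induction m generalizing n with
  | zero => simp [workloadFrom]
  | succ m ih =>
    rw [workloadFrom, workloadFrom]
    exact tsub_le_tsub_right (add_le_add_left (ih (n - 1)) _) _

/-- The stationary workload solves the Lindley recursion on all of `ℤ`. -/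
theorem stationaryWorkload_lindley (a v : ℤ → ℝ≥0∞) (n : ℤ) :
    stationaryWorkload a v (n + 1) = stationaryWorkload a v n + a n - v n := by
  have h : ∀ m, workloadFrom a v (n + 1) (m + 1) = workloadFrom a v n m + a n - v n := by
    intro m
    simp [workloadFrom]
  have h2 : stationaryWorkload a v (n + 1) = ⨆ m, workloadFrom a v (n + 1) (m + 1) :=
    ((workloadFrom_mono a v (n + 1)).iSup_nat_add 1).symm
  rw [h2, stationaryWorkload, ENNReal.iSup_add, ENNReal.iSup_sub]
  simp [h]

/-- The stationary workload is the least solution of the Lindley recursion on `ℤ`. -/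
theorem stationaryWorkload_le (a v w : ℤ → ℝ≥0∞) (hw : ∀ n, w (n + 1) = w n + a n - v n)
    (n : ℤ) : stationaryWorkload a v n ≤ w n := by
  refine iSup_le fun m => ?_
  induction m generalizing n with
  | zero => simp [workloadFrom]
  | succ m ih =>
    have := hw (n - 1)
    rw [sub_add_cancel] at this
    rw [workloadFrom, this]
    exact tsub_le_tsub_right (add_le_add_left (ih (n - 1)) _) _

/-- The bad event `{λ > δ E[s(0) | Φ]}`, where `Φ` is the point process with points `X j`. -/
def badEvent {Ω : Type*} [MeasurableSpace Ω] (P : Measure Ω) (X : ℕ → Ω → Plane)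
    (s : ℝ → Ω → ℝ≥0∞) (δ : ℝ) (lam : ℝ≥0) : Set Ω :=
  {ω | ENNReal.ofReal δ *
      (P⁻[s 0 | MeasurableSpace.comap (fun ω' => countingMeasure fun j => X j ω') inferInstance]) ω
    < lam}

end

end StaticField

/-! Instability. Freeze the interferers. The services in successive slots are then one fixed
function of the fading paths, read along the orbit of the slot shift. Each fading process is
strongly mixing, hence its shift is mixing; mixing survives countable independent products, so the
joint shift is ergodic. The mean ergodic theorem, integrated over the positions, makes the average
past service exceed `δ * E[s(0) | Φ]` by an amount that tends to 0 in `L¹`. Likewise the shortfall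
of the average past arrivals below `lam` tends to 0 in `L¹`. By Fatou the sum of the two errors has
liminf 0 almost surely, so on the bad event infinitely many `m` have arrivals over the last `m`
slots exceeding services by a positive multiple of `m`. This excess is a lower bound for the
workload, and the stationary workload is a supremum over `m`. Main lemmas: `IsMixing.infinitePi`,
`tendsto_lintegral_slotService_average`, `stationaryWorkload_eq_top`.

Positivity of the bad event. Near the origin there is a region `C` of positive area, inside a ball,
where the path loss is at least some `ε > 0`. Let `E N` be the event that `C` holds exactly `N`
points and the rest of the ball none; it has positive probability and depends on `Φ` only. Given `E
N`, the points outside the ball keep their law, while the near interference is at least `ε` times a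
sum of `N` i.i.d. nonzero variables. For large `N` the SINR is therefore small, and so is its rate,
except on two unlikely events. There the rate is at most `h` of the SINR of the far interferers
alone, whose mean is finite (seen on `E 0`) and, after renumbering the fading, independent of `N`.
Hence the mean of `δ * s(0)` given `E N` is below `lam` for some `N`, which is impossible if the bad
event is null. Main lemmas: `setLIntegral_rankPoint`, `rate_le_add_indicators`,
`tendsto_measure_sum_le`. -/

/-! ### Mean ergodic theorem in `L¹`, for functions with values in `[0, ∞]`. -/

section MeanErgodic

variable {S : Type*} [MeasurableSpace S] {Q : Measure S} {T : S → S}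

theorem MeasureTheory.MeasurePreserving.memLp_birkhoffSum (hT : MeasurePreserving T Q Q)
    {f : S → ℝ} {p : ℝ≥0∞} (hf : MemLp f p Q) (m : ℕ) : MemLp (birkhoffSum T f m) p Q := by
  have : birkhoffSum T f m = fun y => ∑ k ∈ Finset.range m, (f ∘ T^[k]) y := rfl
  rw [this]
  exact memLp_finsetSum _ fun k _ => hf.comp_measurePreserving (hT.iterate k)

theorem MeasureTheory.MeasurePreserving.coeFn_birkhoffSum_compMeasurePreserving
    (hT : MeasurePreserving T Q Q) {f : S → ℝ} {p : ℝ≥0∞} (hf : MemLp f p Q) (m : ℕ) :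
    birkhoffSum (Lp.compMeasurePreserving (E := ℝ) (p := p) T hT) _root_.id m (hf.toLp f) =
      (hT.memLp_birkhoffSum hf m).toLp (birkhoffSum T f m) := by
  induction m with
  | zero => simp [birkhoffSum]
  | succ m ih =>
    rw [birkhoffSum_succ, ih, Lp.compMeasurePreserving_iterate, id, Lp.toLp_compMeasurePreserving,
      ← MemLp.toLp_add]
    exact MemLp.toLp_congr _ _ (ae_of_all _ fun y => (birkhoffSum_succ T f m y).symm)

/-- Von Neumann: averages of the Koopman isometry converge in `L²` to the projection onto its fixed
vectors, and ergodicity makes fixed vectors constant. On a probability space the `L¹` norm is at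
most the `L²` norm. -/
theorem Ergodic.exists_tendsto_lintegral_enorm_birkhoffAverage_sub [IsProbabilityMeasure Q]
    (hT : Ergodic T Q) {f : S → ℝ} (hf : MemLp f 2 Q) :
    ∃ c : ℝ, Tendsto (fun m => ∫⁻ y, ‖birkhoffAverage ℝ T f m y - c‖ₑ ∂Q) atTop (𝓝 0) := by
  set U := (Lp.compMeasurePreservingₗᵢ (E := ℝ) (p := 2) ℝ T
    hT.toMeasurePreserving).toContinuousLinearMap with hU
  have hlim := U.tendsto_birkhoffAverage_orthogonalProjection
    (LinearIsometry.norm_toContinuousLinearMap_le _) (hf.toLp f)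
  set p := (U.eqLocus (1 : Lp ℝ 2 Q →L[ℝ] Lp ℝ 2 Q)).orthogonalProjectionOnto (hf.toLp f)
  have hp : U p = p := p.2
  have hp2 : (p : Lp ℝ 2 Q) ∘ T =ᵐ[Q] (p : Lp ℝ 2 Q) := by
    have := Lp.coeFn_compMeasurePreserving (p : Lp ℝ 2 Q) hT.toMeasurePreserving
    refine this.symm.trans ?_
    exact (congrArg (fun g : Lp ℝ 2 Q => (g : S → ℝ)) hp).eventuallyEq
  obtain ⟨c, hc⟩ := hT.ae_eq_const_of_ae_eq_comp_ae (Lp.aestronglyMeasurable _) hp2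
  refine ⟨c, ?_⟩
  rw [tendsto_iff_edist_tendsto_0] at hlim
  refine tendsto_of_tendsto_of_tendsto_of_le_of_le tendsto_const_nhds hlim (fun _ => zero_le)
    fun m => ?_
  have havg : (birkhoffAverage ℝ U _root_.id m (hf.toLp f) : Lp ℝ 2 Q) =ᵐ[Q] birkhoffAverage ℝ T f m := by
    have h1 : birkhoffAverage ℝ U _root_.id m (hf.toLp f) = (m : ℝ)⁻¹ •
      (hT.memLp_birkhoffSum hf m).toLp (birkhoffSum T f m) := by
      rw [← hT.coeFn_birkhoffSum_compMeasurePreserving hf m]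
      rfl
    rw [h1]
    filter_upwards [Lp.coeFn_smul (m : ℝ)⁻¹ ((hT.memLp_birkhoffSum hf m).toLp _),
      (hT.memLp_birkhoffSum hf m).coeFn_toLp] with y h1 h2
    rw [h1, Pi.smul_apply, h2]
    rfl
  have hmeas : AEStronglyMeasurable (birkhoffAverage ℝ U _root_.id m (hf.toLp f) - p.1 :
      Lp ℝ 2 Q) Q := Lp.aestronglyMeasurable _
  calc ∫⁻ y, ‖birkhoffAverage ℝ T f m y - c‖ₑ ∂Q
      = ∫⁻ y, ‖(birkhoffAverage ℝ U _root_.id m (hf.toLp f) - p.1 : Lp ℝ 2 Q) y‖ₑ ∂Q := by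
        refine lintegral_congr_ae ?_
        filter_upwards [havg, hc, Lp.coeFn_sub (birkhoffAverage ℝ U _root_.id m (hf.toLp f)) p.1]
          with y h1 h2 h3
        rw [h3, Pi.sub_apply, h1, h2]
        rfl
    _ = eLpNorm (birkhoffAverage ℝ U _root_.id m (hf.toLp f) - p.1 : Lp ℝ 2 Q) 1 Q :=
        eLpNorm_one_eq_lintegral_enorm.symm
    _ ≤ eLpNorm (birkhoffAverage ℝ U _root_.id m (hf.toLp f) - p.1 : Lp ℝ 2 Q) 2 Q :=
        eLpNorm_le_eLpNorm_of_exponent_le (by norm_num) hmeas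
    _ = edist (birkhoffAverage ℝ U _root_.id m (hf.toLp f)) p.1 := by
        rw [edist_eq_enorm_sub, Lp.enorm_def]

theorem MeasureTheory.MeasurePreserving.integral_birkhoffAverage
    (hT : MeasurePreserving T Q Q) {f : S → ℝ} (hf : Integrable f Q) {m : ℕ} (hm : m ≠ 0) :
    ∫ y, birkhoffAverage ℝ T f m y ∂Q = ∫ y, f y ∂Q := by
  have h1 : ∀ k, ∫ y, f (T^[k] y) ∂Q = ∫ y, f y ∂Q := fun k => by
    have := hT.iterate k
    conv_rhs => rw [← this.map_eq]
    rw [integral_map this.aemeasurable]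
    rw [this.map_eq]; exact hf.1
  simp only [birkhoffAverage, birkhoffSum, smul_eq_mul]
  rw [integral_const_mul, integral_finsetSum]
  · simp only [h1]
    simp
    field_simp
  · intro k _
    exact ((hT.iterate k).integrable_comp hf.1).2 hf

theorem Ergodic.tendsto_lintegral_enorm_birkhoffAverage_sub [IsProbabilityMeasure Q]
    (hT : Ergodic T Q) {f : S → ℝ} (hf : MemLp f 2 Q) :
    Tendsto (fun m => ∫⁻ y, ‖birkhoffAverage ℝ T f m y - ∫ z, f z ∂Q‖ₑ ∂Q) atTop (𝓝 0) := by
  obtain ⟨c, hc⟩ := hT.exists_tendsto_lintegral_enorm_birkhoffAverage_sub hf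
  have hfi : Integrable f Q := hf.integrable (by norm_num)
  suffices ∫ z, f z ∂Q = c by rwa [this]
  -- The limit constant is found by integrating: every average has the same integral as `f`.
  have h0 : ‖∫ z, f z ∂Q - c‖ₑ ≤ 0 := by
    refine ge_of_tendsto hc ?_
    filter_upwards [eventually_ne_atTop 0] with m hm
    have hi : Integrable (birkhoffAverage ℝ T f m) Q :=
      ((hT.memLp_birkhoffSum hf m).integrable (by norm_num)).const_mul (m : ℝ)⁻¹
    have : ∫ z, f z ∂Q - c = ∫ y, (birkhoffAverage ℝ T f m y - c) ∂Q := by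
      rw [integral_sub hi (integrable_const c), hT.integral_birkhoffAverage hfi hm]
      simp
    rw [this]
    exact enorm_integral_le_lintegral_enorm _
  simpa [sub_eq_zero] using h0

/-- The average of `f` along the first `m` points of the orbit of `y` under `T`. -/
noncomputable def orbitAverage (T : S → S) (f : S → ℝ≥0∞) (m : ℕ) (y : S) : ℝ≥0∞ :=
  (m : ℝ≥0∞)⁻¹ * ∑ k ∈ Finset.range m, f (T^[k] y)

theorem measurable_orbitAverage (hT : Measurable T) {f : S → ℝ≥0∞} (hf : Measurable f) (m : ℕ) :
    Measurable (orbitAverage T f m) :=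
  (Finset.measurable_fun_sum _ fun k _ => hf.comp (hT.iterate k)).const_mul _

omit [MeasurableSpace S] in
theorem orbitAverage_add (f f' : S → ℝ≥0∞) (m : ℕ) (y : S) :
    orbitAverage T (f + f') m y = orbitAverage T f m y + orbitAverage T f' m y := by
  simp [orbitAverage, Finset.sum_add_distrib, mul_add]

theorem MeasureTheory.MeasurePreserving.lintegral_orbitAverage (hT : MeasurePreserving T Q Q)
    {f : S → ℝ≥0∞} (hf : Measurable f) {m : ℕ} (hm : m ≠ 0) :
    ∫⁻ y, orbitAverage T f m y ∂Q = ∫⁻ y, f y ∂Q := by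
  have hk : ∀ k, Measurable fun y => f (T^[k] y) := fun k => hf.comp (hT.measurable.iterate k)
  simp only [orbitAverage]
  rw [lintegral_const_mul _ (Finset.measurable_fun_sum _ fun k _ => hk k), lintegral_finsetSum _ fun k _ => hk k]
  simp only [fun k => (hT.iterate k).lintegral_comp hf]
  simp only [Finset.sum_const, Finset.card_range, nsmul_eq_mul]
  rw [← mul_assoc, ENNReal.inv_mul_cancel (by simpa using hm) (by simp), one_mul]

/-- A bounded function is in `L²`, so the real-valued result applies. In `[0, ∞]` the distance of
two finite values is the sum of both truncated differences, one of which vanishes. -/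
theorem Ergodic.tendsto_lintegral_orbitAverage_of_bounded [IsProbabilityMeasure Q]
    (hT : Ergodic T Q) {f : S → ℝ≥0∞} (hf : Measurable f) {K : ℝ≥0} (hK : ∀ y, f y ≤ K) :
    Tendsto (fun m => ∫⁻ y, ((orbitAverage T f m y - ∫⁻ z, f z ∂Q) +
      (∫⁻ z, f z ∂Q - orbitAverage T f m y)) ∂Q) atTop (𝓝 0) := by
  have hfin : ∀ y, f y ≠ ∞ := fun y => ((hK y).trans_lt ENNReal.coe_lt_top).ne
  set f' : S → ℝ := fun y => (f y).toReal with hf'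
  have hf'm : MemLp f' 2 Q := by
    refine MemLp.of_bound hf.ennreal_toReal.aestronglyMeasurable (K : ℝ) (ae_of_all _ fun y => ?_)
    rw [Real.norm_of_nonneg ENNReal.toReal_nonneg]
    exact ENNReal.toReal_le_coe_of_le_coe (hK y)
  have hint : ∫⁻ z, f z ∂Q ≠ ∞ := by
    refine ((lintegral_mono hK).trans_lt ?_).ne
    simp
  have hc : ∫ z, f' z ∂Q = (∫⁻ z, f z ∂Q).toReal :=
    integral_toReal hf.aemeasurable (ae_of_all _ fun y => (hfin y).lt_top)
  have havg : ∀ m y, birkhoffAverage ℝ T f' m y = (orbitAverage T f m y).toReal := by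
    intro m y
    simp [birkhoffAverage, birkhoffSum, orbitAverage, hf', ENNReal.toReal_sum (fun _ _ => hfin _)]
  have key : ∀ a b : ℝ≥0∞, a ≠ ∞ → b ≠ ∞ → (a - b) + (b - a) ≤ ‖a.toReal - b.toReal‖ₑ := by
    intro a b ha hb
    lift a to ℝ≥0 using ha
    lift b to ℝ≥0 using hb
    rw [← edist_eq_enorm_sub]
    change _ ≤ edist (a : ℝ) (b : ℝ)
    rw [edist_dist, ← ENNReal.coe_sub, ← ENNReal.coe_sub, ← ENNReal.coe_add, Real.dist_eq]
    rw [ENNReal.le_ofReal_iff_toReal_le (by simp) (abs_nonneg _)]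
    simp only [ENNReal.coe_toReal, NNReal.coe_add]
    rcases le_total a b with h | h
    · rw [tsub_eq_zero_of_le h, NNReal.coe_sub h, abs_of_nonpos (by simpa using h)]; simp
    · rw [tsub_eq_zero_of_le h, NNReal.coe_sub h, abs_of_nonneg (by simpa using h)]; simp
  refine tendsto_of_tendsto_of_tendsto_of_le_of_le tendsto_const_nhds
    (hT.tendsto_lintegral_enorm_birkhoffAverage_sub hf'm) (fun _ => zero_le) fun m => ?_
  refine lintegral_mono fun y => ?_
  rw [havg, hc]
  -- For `m = 0` the average is `∞ * 0 = 0`, still finite.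
  by_cases hm : m = 0
  · subst hm
    refine key _ _ ?_ hint
    simp [orbitAverage]
  · refine key _ _ ?_ hint
    refine ENNReal.mul_ne_top (by simpa using hm) ?_
    exact (ENNReal.sum_lt_top.2 fun k _ => (hfin _).lt_top).ne

/-- **Mean ergodic theorem** in `L¹`. -/
theorem Ergodic.tendsto_lintegral_orbitAverage [IsProbabilityMeasure Q]
    (hT : Ergodic T Q) {f : S → ℝ≥0∞} (hf : Measurable f) (hfi : ∫⁻ z, f z ∂Q ≠ ∞) :
    Tendsto (fun m => ∫⁻ y, ((orbitAverage T f m y - ∫⁻ z, f z ∂Q) +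
      (∫⁻ z, f z ∂Q - orbitAverage T f m y)) ∂Q) atTop (𝓝 0) := by
  rw [ENNReal.tendsto_nhds_zero]
  intro ε hε
  have hlim : Tendsto (fun K : ℕ => ∫⁻ z, (f z - K) ∂Q) atTop (𝓝 0) := by
    have := tendsto_lintegral_of_dominated_convergence (μ := Q) (F := fun (K : ℕ) z => f z - K)
      (f := fun _ => 0) f (fun K => hf.sub_const _) (fun K => ae_of_all _ fun y => tsub_le_self) hfi
      (by
        filter_upwards [ae_lt_top hf hfi] with y hy
        obtain ⟨N, hN⟩ := ENNReal.exists_nat_gt hy.ne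
        refine tendsto_atTop_of_eventually_const (i₀ := N) fun K hK => ?_
        exact tsub_eq_zero_of_le (hN.le.trans (by exact_mod_cast hK)))
    simpa using this
  have hε3 : 0 < ε / 3 := ENNReal.div_pos hε.ne' (by norm_num)
  obtain ⟨K, hK⟩ := ((ENNReal.tendsto_nhds_zero.1 hlim) _ hε3).exists
  -- Truncation at a level `K` with small tail integral. The tail `f₂` costs at most twice its
  -- integral: once in the orbit average, whose integral is preserved, and once in the mean.
  set f₁ : S → ℝ≥0∞ := fun y => min (f y) K with hf₁
  set f₂ : S → ℝ≥0∞ := fun y => f y - K with hf₂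
  have hf₁m : Measurable f₁ := hf.min measurable_const
  have hf₂m : Measurable f₂ := hf.sub_const _
  have hsum : f = f₁ + f₂ := by
    ext y
    simp only [hf₁, hf₂, Pi.add_apply]
    rw [add_comm, tsub_add_min]
  have hi : ∫⁻ z, f z ∂Q = ∫⁻ z, f₁ z ∂Q + ∫⁻ z, f₂ z ∂Q := by
    rw [hsum]; exact lintegral_add_left hf₁m _
  have hb := hT.tendsto_lintegral_orbitAverage_of_bounded hf₁m (K := K)
    (fun y => by simp [hf₁])
  filter_upwards [(ENNReal.tendsto_nhds_zero.1 hb) _ hε3, eventually_ne_atTop 0] with m hm hm0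
  set c₁ := ∫⁻ z, f₁ z ∂Q
  set c₂ := ∫⁻ z, f₂ z ∂Q
  have hpt : ∀ a₁ a₂ : ℝ≥0∞, (a₁ + a₂ - (c₁ + c₂)) + ((c₁ + c₂) - (a₁ + a₂)) ≤
      ((a₁ - c₁) + (c₁ - a₁)) + (a₂ + c₂) := by
    intro a₁ a₂
    have h1 : a₁ + a₂ - (c₁ + c₂) ≤ (a₁ - c₁) + a₂ := by
      rw [tsub_le_iff_right]
      calc a₁ + a₂ ≤ ((a₁ - c₁) + c₁) + a₂ := by gcongr; exact le_tsub_add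
        _ ≤ ((a₁ - c₁) + c₁) + a₂ + c₂ := le_self_add
        _ = _ := by ring
    have h2 : (c₁ + c₂) - (a₁ + a₂) ≤ (c₁ - a₁) + c₂ := by
      rw [tsub_le_iff_right]
      calc c₁ + c₂ ≤ ((c₁ - a₁) + a₁) + c₂ := by gcongr; exact le_tsub_add
        _ ≤ ((c₁ - a₁) + a₁) + c₂ + a₂ := le_self_add
        _ = _ := by ring
    calc _ ≤ _ := add_le_add h1 h2
      _ = _ := by ring
  calc ∫⁻ y, ((orbitAverage T f m y - ∫⁻ z, f z ∂Q) +
      (∫⁻ z, f z ∂Q - orbitAverage T f m y)) ∂Q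
      ≤ ∫⁻ y, (((orbitAverage T f₁ m y - c₁) + (c₁ - orbitAverage T f₁ m y)) +
        (orbitAverage T f₂ m y + c₂)) ∂Q := by
        refine lintegral_mono fun y => ?_
        have := hpt (orbitAverage T f₁ m y) (orbitAverage T f₂ m y)
        rwa [← orbitAverage_add, ← hsum, ← hi] at this
    _ = ∫⁻ y, ((orbitAverage T f₁ m y - c₁) + (c₁ - orbitAverage T f₁ m y)) ∂Q + (c₂ + c₂) := by
        have h2 := measurable_orbitAverage hT.measurable hf₂m m
        rw [lintegral_add_right _ (h2.add_const _), lintegral_add_right _ measurable_const,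
          hT.toMeasurePreserving.lintegral_orbitAverage hf₂m hm0]
        simp [c₂]
    _ ≤ ε / 3 + (ε / 3 + ε / 3) := by gcongr
    _ = ε := by rw [← add_assoc]; exact ENNReal.add_thirds ε

end MeanErgodic

/-! ### Mixing transformations: ergodicity, reduction to a π-system, infinite products. -/

section Mixing

variable {S : Type*} [MeasurableSpace S]

/-- A transformation is (strongly) mixing if all events `A` and `T⁻ⁿ B` decorrelate as `n → ∞`. -/
def IsMixing (T : S → S) (Q : Measure S) : Prop :=
  ∀ A B : Set S, MeasurableSet A → MeasurableSet B →
    Tendsto (fun n : ℕ => Q.real (A ∩ T^[n] ⁻¹' B)) atTop (𝓝 (Q.real A * Q.real B))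

theorem IsMixing.ergodic {T : S → S} {Q : Measure S} [IsProbabilityMeasure Q]
    (hT : MeasurePreserving T Q Q) (h : IsMixing T Q) : Ergodic T Q := by
  refine ⟨hT, ⟨fun A hA hinv => ?_⟩⟩
  have hiter : ∀ n : ℕ, T^[n] ⁻¹' A = A := fun n => by
    rw [Set.preimage_iterate_eq]
    exact Function.iterate_fixed hinv n
  have hlim := h A A hA hA
  simp only [hiter, Set.inter_self] at hlim
  -- An invariant set is asymptotically independent of itself.
  have heq : Q.real A = Q.real A * Q.real A := tendsto_nhds_unique tendsto_const_nhds hlim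
  rw [eventuallyConst_set', ae_eq_empty, ae_eq_univ, prob_compl_eq_zero_iff hA]
  rcases eq_or_ne (Q.real A) 0 with h0 | h0
  · exact Or.inl ((measureReal_eq_zero_iff).1 h0)
  · right
    have h1 : Q.real A = 1 := (mul_eq_left₀ h0).1 heq.symm
    rw [← ENNReal.toReal_eq_one_iff]
    exact h1

/-- If finite measures dominated by `Q` converge to a multiple of `Q` on a π-system generating the
σ-algebra, then they converge on all measurable sets. -/
theorem tendsto_measureReal_of_isPiSystem {Q : Measure S} [IsFiniteMeasure Q]
    {μ : ℕ → Measure S} (hμ : ∀ n, μ n ≤ Q) {a : ℝ} {C : Set (Set S)} (hC : IsPiSystem C)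
    (hgen : ‹MeasurableSpace S› = MeasurableSpace.generateFrom C)
    (huniv : Tendsto (fun n => (μ n).real Set.univ) atTop (𝓝 (a * Q.real Set.univ)))
    (h : ∀ A ∈ C, Tendsto (fun n => (μ n).real A) atTop (𝓝 (a * Q.real A)))
    {A : Set S} (hA : MeasurableSet A) :
    Tendsto (fun n => (μ n).real A) atTop (𝓝 (a * Q.real A)) := by
  have : ∀ n, IsFiniteMeasure (μ n) := fun n => isFiniteMeasure_of_le Q (hμ n)
  induction A, hA using MeasurableSpace.induction_on_inter hgen hC with
  | empty => simp
  | basic A hA => exact h A hA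
  | compl A hA ih =>
    simp only [measureReal_compl hA]
    rw [mul_sub]
    exact huniv.sub ih
  | iUnion f hd hf ih =>
    have hsum : ∀ (ν : Measure S) [IsFiniteMeasure ν], HasSum (fun i => ν.real (f i))
        (ν.real (⋃ i, f i)) := fun ν _ => by
      have h1 : ∑' i, ν (f i) = ν (⋃ i, f i) := (measure_iUnion hd hf).symm
      simp only [measureReal_def, ← h1]
      rw [ENNReal.tsum_toReal_eq fun _ => measure_ne_top _ _]
      exact ENNReal.hasSum_toReal (h1 ▸ measure_ne_top _ _)
    rw [← (hsum Q).tsum_eq, ← tsum_mul_left]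
    simp only [fun n => (hsum (μ n)).tsum_eq.symm]
    refine tendsto_tsum_of_dominated_convergence (bound := fun i => Q.real (f i))
      (hsum Q).summable ih (Eventually.of_forall fun n i => ?_)
    rw [Real.norm_of_nonneg measureReal_nonneg]
    exact ENNReal.toReal_mono (measure_ne_top _ _) (hμ n _)

/-- With one of the two sets fixed, `Q (A ∩ T⁻ⁿ B)` is a measure in the other set and is dominated
by `Q` (by invariance of `Q` when `B` varies). The limit thus extends from the π-system first in
`B`, then in `A`. -/
theorem isMixing_of_isPiSystem {T : S → S} {Q : Measure S} [IsProbabilityMeasure Q]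
    (hT : MeasurePreserving T Q Q) {C : Set (Set S)} (hC : IsPiSystem C)
    (hgen : ‹MeasurableSpace S› = MeasurableSpace.generateFrom C)
    (h : ∀ A ∈ C, ∀ B ∈ C,
      Tendsto (fun n : ℕ => Q.real (A ∩ T^[n] ⁻¹' B)) atTop (𝓝 (Q.real A * Q.real B))) :
    IsMixing T Q := by
  have hCm : ∀ A ∈ C, MeasurableSet A := fun A hA => by
    rw [hgen]; exact MeasurableSpace.measurableSet_generateFrom hA
  have step : ∀ A ∈ C, ∀ B, MeasurableSet B →
      Tendsto (fun n : ℕ => Q.real (A ∩ T^[n] ⁻¹' B)) atTop (𝓝 (Q.real A * Q.real B)) := by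
    intro A hA B hB
    have hr : ∀ n : ℕ, ∀ B, MeasurableSet B → ((Q.restrict A).map T^[n]).real B =
        Q.real (A ∩ T^[n] ⁻¹' B) := fun n B hB => by
      rw [map_measureReal_apply (hT.iterate n).measurable hB,
        measureReal_restrict_apply ((hT.iterate n).measurable hB), Set.inter_comm]
    have := tendsto_measureReal_of_isPiSystem (Q := Q) (μ := fun n => (Q.restrict A).map T^[n])
      (a := Q.real A) (fun n => ?_) hC hgen ?_ ?_ hB
    · simpa only [hr _ B hB] using this
    · calc (Q.restrict A).map T^[n] ≤ Q.map T^[n] :=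
            Measure.map_mono Measure.restrict_le_self (hT.iterate n).measurable
        _ = Q := (hT.iterate n).map_eq
    · simp [hr _ _ MeasurableSet.univ]
    · intro B hB
      simpa only [hr _ B (hCm B hB)] using h A hA B hB
  intro A B hA hB
  have hm : ∀ n : ℕ, MeasurableSet (T^[n] ⁻¹' B) := fun n => (hT.iterate n).measurable hB
  have hr : ∀ n : ℕ, ∀ A, (Q.restrict (T^[n] ⁻¹' B)).real A =
      Q.real (A ∩ T^[n] ⁻¹' B) := fun n A => measureReal_restrict_apply' (hm n)
  have := tendsto_measureReal_of_isPiSystem (Q := Q) (μ := fun n => Q.restrict (T^[n] ⁻¹' B))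
    (a := Q.real B) (fun n => Measure.restrict_le_self) hC hgen ?_ ?_ hA
  · simpa only [hr, mul_comm] using this
  · simp only [hr, Set.univ_inter, fun n => (hT.iterate n).measureReal_preimage hB.nullMeasurableSet]
    simp
  · intro A hA
    simpa only [hr, mul_comm] using step A hA B hB

theorem iterate_piMap {ι : Type*} {W : ι → Type*} (T : ∀ i, W i → W i) (n : ℕ) :
    (fun (y : ∀ i, W i) i => T i (y i))^[n] = fun y i => (T i)^[n] (y i) := by
  induction n with
  | zero => rfl
  | succ n ih => rw [Function.iterate_succ, ih]; rfl

/-- Any product of mixing transformations is mixing. -/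
theorem IsMixing.infinitePi {ι : Type*} {W : ι → Type*} [∀ i, MeasurableSpace (W i)]
    {Q : ∀ i, Measure (W i)} [∀ i, IsProbabilityMeasure (Q i)] {T : ∀ i, W i → W i}
    (hT : ∀ i, MeasurePreserving (T i) (Q i) (Q i)) (h : ∀ i, IsMixing (T i) (Q i)) :
    IsMixing (fun (y : ∀ i, W i) i => T i (y i)) (Measure.infinitePi Q) := by
  classical
  have hTp : MeasurePreserving (fun (y : ∀ i, W i) i => T i (y i)) (Measure.infinitePi Q)
      (Measure.infinitePi Q) := by
    refine ⟨measurable_pi_lambda _ fun i => (hT i).measurable.comp (measurable_pi_apply i), ?_⟩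
    rw [Measure.infinitePi_map_pi _ fun i => (hT i).measurable]
    simp only [fun i => (hT i).map_eq]
  refine isMixing_of_isPiSystem hTp
    (isPiSystem_squareCylinders (fun i => MeasurableSpace.isPiSystem_measurableSet) (by simp))
    generateFrom_squareCylinders.symm ?_
  rintro _ ⟨s, A, hA, rfl⟩ _ ⟨t, B, hB, rfl⟩
  simp only [Set.mem_univ_pi, Set.mem_ofPred_eq] at hA hB
  -- Both cylinders are rewritten over the common finite index set `s ∪ t`, where all probabilities
  -- are finite products and the limit is taken factor by factor.
  set A' : ∀ i, Set (W i) := fun i => if i ∈ s then A i else Set.univ with hA'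
  set B' : ∀ i, Set (W i) := fun i => if i ∈ t then B i else Set.univ with hB'
  have hA'm : ∀ i, MeasurableSet (A' i) := fun i => by
    simp only [hA']; split_ifs; exacts [hA i, .univ]
  have hB'm : ∀ i, MeasurableSet (B' i) := fun i => by
    simp only [hB']; split_ifs; exacts [hB i, .univ]
  have hsA : (s : Set ι).pi A = ((s ∪ t : Finset ι) : Set ι).pi A' := by
    ext y
    simp only [Set.mem_pi, hA', Finset.mem_coe, Finset.mem_union]
    refine ⟨fun h i _ => ?_, fun h i hi => by simpa [hi] using h i (Or.inl hi)⟩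
    split_ifs with hi
    · exact h i hi
    · trivial
  have htB : (t : Set ι).pi B = ((s ∪ t : Finset ι) : Set ι).pi B' := by
    ext y
    simp only [Set.mem_pi, hB', Finset.mem_coe, Finset.mem_union]
    refine ⟨fun h i _ => ?_, fun h i hi => by simpa [hi] using h i (Or.inr hi)⟩
    split_ifs with hi
    · exact h i hi
    · trivial
  have hpi : ∀ D : ∀ i, Set (W i), (∀ i, MeasurableSet (D i)) →
      (Measure.infinitePi Q).real (((s ∪ t : Finset ι) : Set ι).pi D) =
        ∏ i ∈ s ∪ t, (Q i).real (D i) := fun D hD => by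
    rw [measureReal_def, Measure.infinitePi_pi _ fun i _ => hD i, ENNReal.toReal_prod]
    rfl
  have hinter : ∀ n : ℕ, (((s ∪ t : Finset ι) : Set ι).pi A') ∩
      (fun (y : ∀ i, W i) i => T i (y i))^[n] ⁻¹' (((s ∪ t : Finset ι) : Set ι).pi B') =
      ((s ∪ t : Finset ι) : Set ι).pi fun i => A' i ∩ (T i)^[n] ⁻¹' (B' i) := fun n => by
    rw [iterate_piMap]
    ext y
    simp only [Set.mem_inter_iff, Set.mem_pi, Set.mem_preimage]
    exact ⟨fun h i hi => ⟨h.1 i hi, h.2 i hi⟩, fun h => ⟨fun i hi => (h i hi).1,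
      fun i hi => (h i hi).2⟩⟩
  rw [hsA, htB, hpi _ hA'm, hpi _ hB'm, ← Finset.prod_mul_distrib]
  simp only [hinter]
  simp only [fun n : ℕ => hpi _ fun i => (hA'm i).inter (((hT i).iterate n).measurable (hB'm i))]
  exact tendsto_finsetProd _ fun i _ => h i _ _ (hA'm i) (hB'm i)

end Mixing

namespace StaticField

/-! ### Fading paths at rational multiples of the slot length, and mixing of their shift. -/

section SamplePath

variable {Ω : Type*} [MeasurableSpace Ω] {P : Measure Ω}

/-- The values of the process `Y` at the rational multiples of `δ`, with time origin `c * δ`. -/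
def samplePath (δ c : ℝ) (Y : ℝ → Ω → ℝ≥0) (ω : Ω) : ℚ → ℝ≥0 := fun q => Y ((q + c) * δ) ω

/-- Translation of a rational-time path by one unit. -/
def unitShift (y : ℚ → ℝ≥0) : ℚ → ℝ≥0 := fun q => y (q - 1)

theorem measurable_unitShift : Measurable unitShift :=
  measurable_pi_lambda _ fun q => measurable_pi_apply (q - 1)

theorem iterate_unitShift (n : ℕ) (y : ℚ → ℝ≥0) : unitShift^[n] y = fun q => y (q - n) := by
  induction n generalizing y with
  | zero => simp
  | succ n ih =>
    rw [Function.iterate_succ_apply, ih]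
    ext q
    simp only [unitShift]
    push_cast
    ring_nf

omit [MeasurableSpace Ω] in
theorem iterate_unitShift_samplePath (δ c : ℝ) (Y : ℝ → Ω → ℝ≥0) (n : ℕ) (ω : Ω) :
    unitShift^[n] (samplePath δ c Y ω) = samplePath δ (c - n) Y ω := by
  rw [iterate_unitShift]
  ext q
  simp only [samplePath]
  push_cast
  ring_nf

theorem measurable_samplePath {Y : ℝ → Ω → ℝ≥0} (hY : ∀ t, Measurable (Y t)) (δ c : ℝ) :
    Measurable (samplePath δ c Y) :=
  measurable_pi_lambda _ fun q => hY ((q + c) * δ)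

theorem IsStationary.map_samplePath {Y : ℝ → Ω → ℝ≥0} (hY : ∀ t, Measurable (Y t))
    (h : IsStationary P Y) (δ c : ℝ) :
    P.map (samplePath δ c Y) = P.map (samplePath δ 0 Y) := by
  have hr : Measurable fun (z : ℝ → ℝ≥0) (q : ℚ) => z (q * δ) :=
    measurable_pi_lambda _ fun q => measurable_pi_apply ((q : ℝ) * δ)
  have h1 := congrArg (Measure.map fun (z : ℝ → ℝ≥0) (q : ℚ) => z (q * δ)) (h (c * δ))
  rw [Measure.map_map hr (measurable_pi_lambda _ fun t => hY _),
    Measure.map_map hr (measurable_pi_lambda _ fun t => hY _)] at h1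
  convert h1 using 2
  · ext ω q
    simp [samplePath, add_mul]
  · ext ω q
    simp [samplePath]

theorem IsStationary.measurePreserving_unitShift {Y : ℝ → Ω → ℝ≥0} (hY : ∀ t, Measurable (Y t))
    (h : IsStationary P Y) (δ : ℝ) :
    MeasurePreserving unitShift (P.map (samplePath δ 0 Y)) (P.map (samplePath δ 0 Y)) := by
  refine ⟨measurable_unitShift, ?_⟩
  rw [Measure.map_map measurable_unitShift (measurable_samplePath hY δ 0)]
  rw [← h.map_samplePath hY δ (0 - (1 : ℕ))]
  congr 1
  ext1 ω
  exact iterate_unitShift_samplePath δ 0 Y 1 ω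

/-- The σ-algebra generated by the coordinates in `[-M, M]`. -/
@[reducible] def windowSigma (M : ℕ) : MeasurableSpace (ℚ → ℝ≥0) :=
  ⨆ (q : ℚ) (_ : |q| ≤ M), MeasurableSpace.comap (fun y => y q) inferInstance

theorem windowSigma_mono : Monotone windowSigma := fun M N h =>
  iSup_mono fun q => iSup_mono' fun hq => ⟨hq.trans (by exact_mod_cast h), le_rfl⟩

theorem iSup_windowSigma : ⨆ M, windowSigma M = MeasurableSpace.pi := by
  refine le_antisymm (iSup_le fun M => iSup_le fun q => iSup_le fun _ => le_iSup_of_le q le_rfl)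
    (iSup_le fun q => ?_)
  obtain ⟨M, hM⟩ := exists_nat_ge |q|
  exact le_iSup_of_le M (le_iSup₂_of_le q hM le_rfl)

omit [MeasurableSpace Ω] in
theorem comap_samplePath_windowSigma_le {δ : ℝ} (c : ℝ) (Y : ℝ → Ω → ℝ≥0) (M : ℕ) {U : Set ℝ}
    (hU : ∀ q : ℚ, |q| ≤ M → (q + c) * δ ∈ U) :
    MeasurableSpace.comap (samplePath δ c Y) (windowSigma M) ≤ sigmaOn Y U := by
  simp only [windowSigma, MeasurableSpace.comap_iSup]
  refine iSup₂_le fun q hq => ?_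
  rw [MeasurableSpace.comap_comp]
  exact le_iSup₂_of_le ((q + c) * δ) (hU q hq) le_rfl

theorem abs_sub_le_mixingCoeff {Ω : Type*} {𝒜 ℬ : MeasurableSpace Ω} [MeasurableSpace Ω]
    {P : Measure Ω} [IsProbabilityMeasure P] {A B : Set Ω}
    (hA : MeasurableSet[𝒜] A) (hB : MeasurableSet[ℬ] B) :
    |P.real (A ∩ B) - P.real A * P.real B| ≤ mixingCoeff P 𝒜 ℬ := by
  refine le_csSup ⟨1, ?_⟩ ⟨A, B, hA, hB, rfl⟩
  rintro r ⟨A, B, -, -, rfl⟩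
  have h1 : P.real A * P.real B ≤ 1 :=
    mul_le_one₀ measureReal_le_one measureReal_nonneg measureReal_le_one
  have h2 : 0 ≤ P.real A * P.real B := mul_nonneg measureReal_nonneg measureReal_nonneg
  have h3 : P.real (A ∩ B) ≤ 1 := measureReal_le_one
  have h4 : 0 ≤ P.real (A ∩ B) := measureReal_nonneg
  rw [abs_le]
  constructor <;> linarith

/-- Events that depend on the coordinates in a bounded window form a generating π-system. For two of
them the shift separates the time windows, and the mixing coefficient bounds their correlation. -/
theorem IsStronglyMixing.isMixing_unitShift [IsProbabilityMeasure P] {Y : ℝ → Ω → ℝ≥0}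
    (hY : ∀ t, Measurable (Y t)) (hs : IsStationary P Y) (h : IsStronglyMixing P Y) {δ : ℝ}
    (hδ : 0 < δ) : IsMixing unitShift (P.map (samplePath δ 0 Y)) := by
  have hprob : IsProbabilityMeasure (P.map (samplePath δ 0 Y)) :=
    Measure.isProbabilityMeasure_map (measurable_samplePath hY δ 0).aemeasurable
  refine isMixing_of_isPiSystem (hs.measurePreserving_unitShift hY δ)
    (isPiSystem_iUnion_of_monotone (fun M => {A | MeasurableSet[windowSigma M] A})
      (fun M => @MeasurableSpace.isPiSystem_measurableSet _ (windowSigma M))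
      fun M N hMN A hA => windowSigma_mono hMN A hA)
    ((MeasurableSpace.generateFrom_iUnion_measurableSet windowSigma).trans iSup_windowSigma).symm ?_
  intro A hA B hB
  obtain ⟨M₁, hA⟩ := Set.mem_iUnion.1 hA
  obtain ⟨M₂, hB⟩ := Set.mem_iUnion.1 hB
  set M := max M₁ M₂
  replace hA : MeasurableSet[windowSigma M] A := windowSigma_mono (le_max_left _ _) A hA
  replace hB : MeasurableSet[windowSigma M] B := windowSigma_mono (le_max_right _ _) B hB
  have hle : windowSigma M ≤ MeasurableSpace.pi := iSup_windowSigma ▸ le_iSup windowSigma M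
  have hA' := hle A hA
  have hB' := hle B hB
  rw [tendsto_iff_dist_tendsto_zero]
  have hlim : Tendsto (fun n : ℕ => ((n : ℝ) - 2 * M) * δ) atTop atTop :=
    (tendsto_atTop_add_const_right _ _ tendsto_natCast_atTop_atTop).atTop_mul_const hδ
  refine squeeze_zero (fun _ => dist_nonneg) (fun n => ?_) (h.comp hlim)
  have hshift : ∀ (c : ℝ) (D : Set (ℚ → ℝ≥0)), MeasurableSet D →
      (P.map (samplePath δ 0 Y)).real D = P.real (samplePath δ c Y ⁻¹' D) := fun c D hD => by
    rw [← hs.map_samplePath hY δ c, map_measureReal_apply (measurable_samplePath hY δ c) hD]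
  -- Stationarity allows a choice of time origin: with `n - M` for `A` and `-M` for `B`, the window
  -- of `B` ends at time `0` and that of `A` starts at `(n - 2 * M) * δ`.
  rw [hshift (n - M) _ (hA'.inter (((hs.measurePreserving_unitShift hY δ).iterate n).measurable hB')),
    hshift (n - M) A hA', hshift (-M) B hB', Real.dist_eq]
  have hpre : samplePath δ (n - M) Y ⁻¹' (A ∩ unitShift^[n] ⁻¹' B) =
      samplePath δ (-M) Y ⁻¹' B ∩ samplePath δ (n - M) Y ⁻¹' A := by
    ext ω
    simp only [Set.mem_preimage, Set.mem_inter_iff, iterate_unitShift_samplePath]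
    rw [show (n : ℝ) - M - n = -M by ring, and_comm]
  rw [hpre, mul_comm]
  refine abs_sub_le_mixingCoeff (comap_samplePath_windowSigma_le _ Y M (fun q hq => ?_) _ ⟨B, hB, rfl⟩)
    (comap_samplePath_windowSigma_le _ Y M (fun q hq => ?_) _ ⟨A, hA, rfl⟩)
  · have : (q : ℝ) ≤ M := by exact_mod_cast (abs_le.1 hq).2
    exact mul_nonpos_of_nonpos_of_nonneg (by linarith) hδ.le
  · have : -(M : ℝ) ≤ q := by exact_mod_cast (abs_le.1 hq).1
    exact mul_le_mul_of_nonneg_right (by linarith) hδ.le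

end SamplePath

/-! ### Recovering the ordered distances of the points from the point measure. -/

section Rank

theorem countingMeasure_apply (x : ℕ → Plane) {B : Set Plane} (hB : MeasurableSet B) :
    countingMeasure x B = Measure.count {i | x i ∈ B} := by
  rw [countingMeasure, Measure.sum_apply _ hB, Measure.count, Measure.sum_apply _ (MeasurableSet.of_discrete)]
  refine tsum_congr fun i => ?_
  rw [Measure.dirac_apply' _ hB, Measure.dirac_apply]
  rfl

theorem measurable_countingMeasure : Measurable countingMeasure := by
  refine Measure.measurable_of_measurable_coe _ fun B hB => ?_
  simp only [countingMeasure, Measure.sum_apply _ hB, Measure.dirac_apply' _ hB]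
  exact Measurable.tsum fun i =>
    (measurable_one.indicator hB).comp (measurable_pi_apply i)

/-- The annulus of the points whose distance to the origin is in `[b, b + r)`. -/
def annulus (b r : ℝ) : Set Plane := Metric.ball 0 (b + r) \ Metric.ball 0 b

theorem mem_annulus {b r : ℝ} {y : Plane} : y ∈ annulus b r ↔ b ≤ ‖y‖ ∧ ‖y‖ < b + r := by
  simp [annulus, and_comm]

theorem measurableSet_annulus (b r : ℝ) : MeasurableSet (annulus b r) :=
  measurableSet_ball.diff measurableSet_ball

/-- The distance from the origin of the `j`-th point (counted from `0`) of the point measure `μ`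
outside the ball of radius `b`. -/
noncomputable def rankRadius (b : ℝ) (μ : Measure Plane) (j : ℕ) : ℝ≥0∞ :=
  ⨅ (k : ℕ) (i : ℕ) (_ : (j + 1 : ℝ≥0∞) ≤ μ (annulus b (i / 2 ^ k))), ENNReal.ofReal (b + i / 2 ^ k)

/-- A point at distance `rankRadius b μ j` from the origin. -/
noncomputable def rankPoint (b : ℝ) (μ : Measure Plane) (j : ℕ) : Plane :=
  EuclideanSpace.single 0 (rankRadius b μ j).toReal

theorem measurable_rankPoint_of_measurable {Ω : Type*} [MeasurableSpace Ω] (b : ℝ)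
    {Φ : Ω → Measure Plane} (hΦ : ∀ k i : ℕ, Measurable fun ω => Φ ω (annulus b (i / 2 ^ k))) :
    Measurable fun ω => rankPoint b (Φ ω) := by
  refine measurable_pi_lambda _ fun j => ?_
  have h1 : Measurable fun ω => rankRadius b (Φ ω) j := by
    refine Measurable.iInf fun k => Measurable.iInf fun i => ?_
    have : (fun ω => ⨅ (_ : (j + 1 : ℝ≥0∞) ≤ Φ ω (annulus b (i / 2 ^ k))),
        ENNReal.ofReal (b + i / 2 ^ k)) = fun ω =>
        if (j + 1 : ℝ≥0∞) ≤ Φ ω (annulus b (i / 2 ^ k)) then ENNReal.ofReal (b + i / 2 ^ k)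
        else ⊤ := by
      ext ω
      split_ifs with h <;> simp [h]
    rw [this]
    exact Measurable.ite (measurableSet_le measurable_const (hΦ k i)) measurable_const
      measurable_const
  have h2 : Continuous fun r : ℝ => (EuclideanSpace.single 0 r : Plane) := by
    refine (PiLp.continuous_toLp 2 _).comp ?_
    exact continuous_pi fun i => by
      by_cases hi : i = 0
      · subst hi; simpa using continuous_id'
      · simpa [hi] using continuous_const
  exact h2.measurable.comp h1.ennreal_toReal

theorem measurable_rankPoint (b : ℝ) : Measurable (rankPoint b) :=
  measurable_rankPoint_of_measurable b fun _ _ => Measure.measurable_coe (measurableSet_annulus _ _)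

/-- The first `N` points lie inside the ball and distances are nondecreasing, so an annulus of inner
radius `b` holds `j + 1` points exactly when its open outer radius exceeds the norm of point `N +
j`. Dyadic outer radii approach this norm from above. -/
theorem norm_rankPoint {x : ℕ → Plane} (hx : Monotone fun j => ‖x j‖) {b : ℝ} (hb : 0 ≤ b) {N : ℕ}
    (hlt : ∀ i < N, ‖x i‖ < b) (hge : ∀ i, N ≤ i → b ≤ ‖x i‖) (j : ℕ) :
    ‖rankPoint b (countingMeasure x) j‖ = ‖x (N + j)‖ := by
  have hcount : ∀ r : ℝ, (j + 1 : ℝ≥0∞) ≤ countingMeasure x (annulus b r) ↔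
      ‖x (N + j)‖ < b + r := by
    intro r
    rw [countingMeasure_apply x (measurableSet_annulus b r)]
    simp only [mem_annulus]
    constructor
    · intro h
      by_contra! hc
      have hsub : {i | b ≤ ‖x i‖ ∧ ‖x i‖ < b + r} ⊆ (Finset.Ico N (N + j) : Set ℕ) := by
        rintro i ⟨h1, h2⟩
        simp only [Finset.coe_Ico, Set.mem_Ico]
        refine ⟨?_, ?_⟩
        · by_contra! hi
          exact absurd (hlt i hi) (not_lt.2 h1)
        · by_contra! hi
          exact absurd (hc.trans (hx hi)) (not_le.2 h2)
      have := h.trans (measure_mono hsub)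
      rw [Measure.count_apply_finset] at this
      simp only [Nat.card_Ico, add_tsub_cancel_left] at this
      have h3 : j + 1 ≤ j := by exact_mod_cast this
      omega
    · intro h
      have hsub : (Finset.Icc N (N + j) : Set ℕ) ⊆ {i | b ≤ ‖x i‖ ∧ ‖x i‖ < b + r} := by
        intro i hi
        simp only [Finset.coe_Icc, Set.mem_Icc] at hi
        exact ⟨hge i hi.1, (hx hi.2).trans_lt h⟩
      refine le_trans ?_ (measure_mono hsub)
      rw [Measure.count_apply_finset]
      simp only [Nat.card_Icc]
      rw [show N + j + 1 - N = j + 1 by omega]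
      simp
  have hrank : rankRadius b (countingMeasure x) j = ENNReal.ofReal ‖x (N + j)‖ := by
    simp only [rankRadius, hcount]
    apply le_antisymm
    · refine ENNReal.le_of_forall_pos_le_add fun ε hε _ => ?_
      obtain ⟨k, hk⟩ := exists_pow_lt_of_lt_one (show (0 : ℝ) < ε from hε)
        (show (1 / 2 : ℝ) < 1 by norm_num)
      set ρ := ‖x (N + j)‖
      have hρ : b ≤ ρ := hge _ (by omega)
      -- The `+ 1` is needed because the annulus excludes its outer radius.
      set i := ⌊(ρ - b) * 2 ^ k⌋₊ + 1
      have hpow : (0 : ℝ) < 2 ^ k := by positivity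
      have h1 : ρ < b + i / 2 ^ k := by
        rw [← sub_lt_iff_lt_add', lt_div_iff₀ hpow]
        push_cast [i]
        exact Nat.lt_floor_add_one _
      have h2 : b + i / 2 ^ k ≤ ρ + ε := by
        have : (i : ℝ) / 2 ^ k ≤ (ρ - b) + (1 / 2) ^ k := by
          rw [div_le_iff₀ hpow, add_mul, ← mul_pow]
          push_cast [i]
          norm_num
          exact Nat.floor_le (by have := sub_nonneg.2 hρ; positivity)
        linarith
      refine (iInf_le_of_le k (iInf_le_of_le i (iInf_le _ h1))).trans ?_
      rw [← ENNReal.ofReal_coe_nnreal, ← ENNReal.ofReal_add (hb.trans hρ) ε.coe_nonneg]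
      exact ENNReal.ofReal_le_ofReal h2
    · exact le_iInf fun k => le_iInf fun i => le_iInf fun h => ENNReal.ofReal_le_ofReal h.le
  simp [rankPoint, hrank]

theorem norm_rankPoint_zero {x : ℕ → Plane} (hx : Monotone fun j => ‖x j‖) (j : ℕ) :
    ‖rankPoint 0 (countingMeasure x) j‖ = ‖x j‖ := by
  simpa using norm_rankPoint hx le_rfl (N := 0) (by simp) (fun i _ => norm_nonneg _) j

/-- By monotonicity the indices of the points inside the ball form an initial segment of `ℕ`, whose
length is the count. -/
theorem norm_lt_iff_of_countingMeasure_ball {x : ℕ → Plane} (hx : Monotone fun j => ‖x j‖) {b : ℝ}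
    {N : ℕ} (h : countingMeasure x (Metric.ball 0 b) = N) (i : ℕ) : ‖x i‖ < b ↔ i < N := by
  rw [countingMeasure_apply x measurableSet_ball] at h
  simp only [mem_ball_zero_iff] at h
  constructor
  · intro hi
    have hsub : (Finset.range (i + 1) : Set ℕ) ⊆ {i | ‖x i‖ < b} := by
      intro k hk
      simp only [Finset.coe_range, Set.mem_Iio] at hk
      exact (hx (show k ≤ i by omega)).trans_lt hi
    have := measure_mono (μ := Measure.count) hsub
    rw [h, Measure.count_apply_finset] at this
    simp only [Finset.card_range] at this
    have h3 : i + 1 ≤ N := by exact_mod_cast this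
    omega
  · intro hi
    by_contra! hc
    have hsub : {i | ‖x i‖ < b} ⊆ (Finset.range i : Set ℕ) := by
      intro k hk
      simp only [Finset.coe_range, Set.mem_Iio]
      by_contra! hk2
      exact absurd (hc.trans (hx hk2)) (not_le.2 hk)
    have := measure_mono (μ := Measure.count) hsub
    rw [h, Measure.count_apply_finset] at this
    simp only [Finset.card_range] at this
    have h3 : N ≤ i := by exact_mod_cast this
    omega

end Rank

/-! ### The SINR as a measurable function of distances and fading. -/

section Sinr

theorem sinr_congr_norm {l : ℝ → ℝ≥0} {R : ℝ} {γ : ℝ≥0} {x x' : ℕ → Plane}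
    (h : ∀ j, ‖x j‖ = ‖x' j‖) (f : ℕ → ℝ≥0) : sinr l R γ x f = sinr l R γ x' f := by
  simp [sinr, interference, h]

theorem measurable_sinr {l : ℝ → ℝ≥0} (hl : Measurable l) (R : ℝ) (γ : ℝ≥0) :
    Measurable fun p : (ℕ → Plane) × (ℕ → ℝ≥0) => sinr l R γ p.1 p.2 := by
  have h1 : Measurable fun p : (ℕ → Plane) × (ℕ → ℝ≥0) => interference l p.1 p.2 := by
    refine Measurable.tsum fun j => Measurable.mul (f := fun p : (ℕ → Plane) × (ℕ → ℝ≥0) =>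
      (l ‖p.1 j‖ : ℝ≥0∞)) (g := fun p => (p.2 (j + 1) : ℝ≥0∞)) ?_ ?_
    · exact (hl.comp ((measurable_pi_apply j).comp measurable_fst).norm).coe_nnreal_ennreal
    · exact ((measurable_pi_apply (j + 1)).comp measurable_snd).coe_nnreal_ennreal
  have h2 : Measurable fun p : (ℕ → Plane) × (ℕ → ℝ≥0) => (p.2 0 : ℝ≥0∞) :=
    ((measurable_pi_apply 0).comp measurable_snd).coe_nnreal_ennreal
  exact (h2.const_mul _).div (h1.add_const _)

end Sinr

/-! ### Conditional expectation given the point process. -/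

section CondExp

variable {Ω : Type*} [MeasurableSpace Ω] {P : Measure Ω} [IsProbabilityMeasure P]

theorem lintegral_comp_of_indepFun {α β : Type*} [MeasurableSpace α] [MeasurableSpace β]
    {X : Ω → α} {Z : Ω → β} (hX : Measurable X) (hZ : Measurable Z) (h : IndepFun X Z P)
    {H : α × β → ℝ≥0∞} (hH : Measurable H) :
    ∫⁻ ω, H (X ω, Z ω) ∂P = ∫⁻ ω, ∫⁻ ω', H (X ω, Z ω') ∂P ∂P := by
  have h1 := (indepFun_iff_map_prod_eq_prod_map_map hX.aemeasurable hZ.aemeasurable).1 h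
  have := Measure.isProbabilityMeasure_map (μ := P) hX.aemeasurable
  have := Measure.isProbabilityMeasure_map (μ := P) hZ.aemeasurable
  rw [← lintegral_map (f := H) hH (hX.prodMk hZ), h1, lintegral_prod _ hH.aemeasurable,
    lintegral_map hH.lintegral_prod_right' hX]
  refine lintegral_congr fun ω => ?_
  exact lintegral_map (hH.comp measurable_prodMk_left) hZ

/-- The conditional expectation given the point process of a function of the points and of an
independent variable, which depends on the points only through their distances to the origin. -/
theorem condLExp_countingMeasure_ae_eq {β : Type*} [MeasurableSpace β]
    {X : ℕ → Ω → Plane} (hX : ∀ j, Measurable (X j))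
    (hXord : ∀ᵐ ω ∂P, Monotone fun j => ‖X j ω‖)
    {Z : Ω → β} (hZ : Measurable Z) (h : IndepFun (fun ω j => X j ω) Z P)
    {H : (ℕ → Plane) × β → ℝ≥0∞} (hH : Measurable H)
    (hnorm : ∀ x x' z, (∀ j, ‖x j‖ = ‖x' j‖) → H (x, z) = H (x', z)) :
    P⁻[fun ω => H (fun j => X j ω, Z ω) |
      MeasurableSpace.comap (fun ω' => countingMeasure fun j => X j ω') inferInstance] =ᵐ[P]
      fun ω => ∫⁻ ω', H (fun j => X j ω, Z ω') ∂P := by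
  have hXm : Measurable fun ω j => X j ω := measurable_pi_lambda _ hX
  have hΦ : Measurable fun ω' => countingMeasure fun j => X j ω' :=
    measurable_countingMeasure.comp hXm
  have hHint : Measurable fun x : ℕ → Plane => ∫⁻ ω', H (x, Z ω') ∂P :=
    (hH.comp (measurable_fst.prodMk (hZ.comp measurable_snd))).lintegral_prod_right'
  -- The listed positions need not be functions of the point measure, but their distances are. Since
  -- `H` sees only distances, `rankPoint 0` supplies a version measurable with respect to `Φ`.
  have hae : (fun ω => ∫⁻ ω', H (rankPoint 0 (countingMeasure fun j => X j ω), Z ω') ∂P) =ᵐ[P]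
      fun ω => ∫⁻ ω', H (fun j => X j ω, Z ω') ∂P := by
    filter_upwards [hXord] with ω hω
    refine lintegral_congr fun ω' => hnorm _ _ _ fun j => norm_rankPoint_zero hω j
  refine EventuallyEq.trans (EventuallyEq.symm ?_) hae
  refine ae_eq_condLExp hΦ.comap_le P _ ?_ ?_
  · exact (hHint.comp (measurable_rankPoint 0)).comp (comap_measurable _)
  · rintro _ ⟨D, hD, rfl⟩
    have hDm : MeasurableSet ((fun ω' => countingMeasure fun j => X j ω') ⁻¹' D) := hΦ hD
    rw [← lintegral_indicator hDm, ← lintegral_indicator hDm]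
    have hDx : MeasurableSet (countingMeasure ⁻¹' D) := measurable_countingMeasure hD
    have := lintegral_comp_of_indepFun hXm hZ h
      (H := fun p => (countingMeasure ⁻¹' D).indicator (fun _ => (1 : ℝ≥0∞)) p.1 * H p)
      (((measurable_const.indicator hDx).comp measurable_fst).mul hH)
    have hind : ∀ (G : Ω → ℝ≥0∞) ω, ((fun ω' => countingMeasure fun j => X j ω') ⁻¹' D).indicator
        G ω = (countingMeasure ⁻¹' D).indicator (fun _ => (1 : ℝ≥0∞)) (fun j => X j ω) * G ω := by
      intro G ω
      by_cases hω : countingMeasure (fun j => X j ω) ∈ D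
      · rw [Set.indicator_of_mem (by exact hω), Set.indicator_of_mem (by exact hω), one_mul]
      · rw [Set.indicator_of_notMem (by exact hω), Set.indicator_of_notMem (by exact hω), zero_mul]
    simp only [hind]
    rw [this]
    refine lintegral_congr_ae ?_
    filter_upwards [hae] with ω hω
    rw [hω]
    exact (lintegral_const_mul _ (hH.comp (measurable_const.prodMk hZ))).symm

end CondExp

/-! ### Lower bounds on the workload. -/

section Lindley

/-- Truncation at `0` can only raise the workload, so each step satisfies `w k + a k ≤ w (k + 1) + v
k`; these inequalities add up. -/
theorem sum_le_workloadFrom_add_sum (a v : ℤ → ℝ≥0∞) (n : ℤ) (m : ℕ) :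
    ∑ k ∈ Finset.range m, a (n - 1 - k) ≤
      workloadFrom a v n m + ∑ k ∈ Finset.range m, v (n - 1 - k) := by
  induction m generalizing n with
  | zero => simp
  | succ m ih =>
    rw [Finset.sum_range_succ', Finset.sum_range_succ', workloadFrom]
    have h := ih (n - 1)
    have h1 : ∀ (w : ℤ → ℝ≥0∞), ∑ k ∈ Finset.range m, w (n - 1 - ((k + 1 : ℕ) : ℤ)) =
        ∑ k ∈ Finset.range m, w (n - 1 - 1 - k) := fun w =>
      Finset.sum_congr rfl fun k _ => by congr 1; push_cast; ring
    rw [h1, h1]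
    simp only [Nat.cast_zero, sub_zero]
    calc _ ≤ workloadFrom a v (n - 1) m + ∑ k ∈ Finset.range m, v (n - 1 - 1 - k) + a (n - 1) := by
          gcongr
      _ = (workloadFrom a v (n - 1) m + a (n - 1)) + ∑ k ∈ Finset.range m, v (n - 1 - 1 - k) := by
          ring
      _ ≤ (workloadFrom a v (n - 1) m + a (n - 1) - v (n - 1) + v (n - 1)) +
          ∑ k ∈ Finset.range m, v (n - 1 - 1 - k) := add_le_add_left le_tsub_add _
      _ = _ := by ring

/-- The stationary workload is infinite if, along a subsequence, the average arrivals and services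
in the past approach rates for which the queue is overloaded. -/
theorem stationaryWorkload_eq_top {a v : ℤ → ℝ≥0∞} {n : ℤ} {α β : ℝ≥0∞} (hα : α ≠ ∞) (hβ : β < α)
    (h : liminf (fun m : ℕ => ((m : ℝ≥0∞)⁻¹ * ∑ k ∈ Finset.range m, v (n - 1 - k) - β) +
      (α - (m : ℝ≥0∞)⁻¹ * ∑ k ∈ Finset.range m, a (n - 1 - k))) atTop = 0) :
    stationaryWorkload a v n = ∞ := by
  have hβ' : β ≠ ∞ := (hβ.trans_le le_top).ne
  -- A third of the gap: service and arrivals may each err by `η`, and a strict gap remains.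
  obtain ⟨η, hη, hlt⟩ : ∃ η : ℝ≥0, 0 < η ∧ β + η + η < α := by
    have h0 : 0 < (α - β) / 3 := ENNReal.div_pos (tsub_pos_of_lt hβ).ne' (by norm_num)
    have hfin : (α - β) / 3 ≠ ∞ := ENNReal.div_ne_top (ENNReal.sub_ne_top hα) (by norm_num)
    refine ⟨((α - β) / 3).toNNReal, ENNReal.toNNReal_pos h0.ne' hfin, ?_⟩
    rw [ENNReal.coe_toNNReal hfin]
    calc β + (α - β) / 3 + (α - β) / 3
        < β + (α - β) / 3 + (α - β) / 3 + (α - β) / 3 :=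
          ENNReal.lt_add_right (by simp [hβ', hfin]) h0.ne'
      _ = β + ((α - β) / 3 + (α - β) / 3 + (α - β) / 3) := by ring
      _ = α := by rw [ENNReal.add_thirds, add_tsub_cancel_of_le hβ.le]
  have hfreq := frequently_lt_of_liminf_lt (b := (η : ℝ≥0∞)) (by isBoundedDefault)
    (by rw [h]; exact_mod_cast hη)
  have hpos : α - (β + η + η) ≠ 0 := (tsub_pos_of_lt hlt).ne'
  refine ENNReal.eq_top_of_forall_nnreal_le fun r => ?_
  -- The workload will be at least `m` times the remaining gap, so any `m ≥ M` in the subsequence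
  -- beats `r`; `max M 1` keeps `m` invertible.
  obtain ⟨M, hM⟩ := ENNReal.exists_nat_mul_gt hpos (ENNReal.coe_ne_top (r := r))
  obtain ⟨m, hmM, hm⟩ := (frequently_atTop.1 hfreq) (max M 1)
  have hm0 : (m : ℝ≥0∞) ≠ 0 := by
    have : 1 ≤ m := (le_max_right _ _).trans hmM
    simp; omega
  have hmul : ∀ s : ℝ≥0∞, (m : ℝ≥0∞) * ((m : ℝ≥0∞)⁻¹ * s) = s := fun s => by
    rw [← mul_assoc, ENNReal.mul_inv_cancel hm0 (by simp), one_mul]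
  set SA := ∑ k ∈ Finset.range m, a (n - 1 - k)
  set SV := ∑ k ∈ Finset.range m, v (n - 1 - k)
  have hV : SV ≤ m * (β + η) := by
    rw [← hmul SV]
    gcongr
    exact tsub_le_iff_left.1 ((le_self_add.trans hm.le))
  have hA : m * α ≤ SA + m * η := by
    rw [← hmul SA, ← mul_add]
    gcongr
    exact tsub_le_iff_left.1 (le_add_self.trans hm.le)
  have hW := sum_le_workloadFrom_add_sum a v n m
  have htot : m * α ≤ workloadFrom a v n m + m * (β + η + η) := by
    calc m * α ≤ SA + m * η := hA
      _ ≤ (workloadFrom a v n m + SV) + m * η := by gcongr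
      _ ≤ (workloadFrom a v n m + m * (β + η)) + m * η := by gcongr
      _ = _ := by ring
  calc (r : ℝ≥0∞) ≤ M * (α - (β + η + η)) := hM.le
    _ ≤ m * (α - (β + η + η)) := by
      gcongr
      exact (le_max_left _ _).trans hmM
    _ = m * α - m * (β + η + η) := ENNReal.mul_sub fun _ _ => by simp
    _ ≤ workloadFrom a v n m := tsub_le_iff_right.2 htot
    _ ≤ _ := le_iSup (workloadFrom a v n) m

end Lindley

/-! ### The service in a slot as a measurable function of positions and rational-time paths. -/

section Path

/-- The `k`-th dyadic-type approximation `⌊t (k + 1)⌋ / (k + 1)` of `t`. -/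
noncomputable def ratApprox (k : ℕ) (t : ℝ) : ℚ := (⌊t * (k + 1)⌋ : ℚ) / (k + 1)

theorem measurable_ratApprox (k : ℕ) : Measurable (ratApprox k) := by
  have h : Measurable fun z : ℤ => (z : ℚ) / (k + 1) := Measurable.of_discrete
  exact h.comp (Int.measurable_floor.comp (measurable_id.mul_const _))

theorem tendsto_ratApprox (t : ℝ) : Tendsto (fun k => (ratApprox k t : ℝ)) atTop (𝓝 t) := by
  rw [tendsto_iff_dist_tendsto_zero]
  have h3 : Tendsto (fun k : ℕ => 1 / ((k : ℝ) + 1)) atTop (𝓝 0) :=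
    tendsto_one_div_add_atTop_nhds_zero_nat
  refine squeeze_zero (fun _ => dist_nonneg) (fun k => ?_) h3
  have hk : (0 : ℝ) < k + 1 := by positivity
  simp only [ratApprox]
  push_cast
  rw [Real.dist_eq, abs_le, ← neg_div]
  have h4 := Int.floor_le (t * (k + 1))
  have h5 := Int.lt_floor_add_one (t * (k + 1))
  have h6 : (⌊t * ((k : ℝ) + 1)⌋ : ℝ) / (k + 1) - t = ((⌊t * ((k : ℝ) + 1)⌋ : ℝ) - t * (k + 1)) / (k + 1) := by
    field_simp
  rw [h6]
  constructor
  · gcongr; linarith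
  · gcongr; linarith

/-- The value at time `t` of the extension of a rational-time path to real times. -/
noncomputable def pathValue (y : ℚ → ℝ≥0) (t : ℝ) : ℝ≥0 :=
  (limsup (fun k => (y (ratApprox k t) : ℝ≥0∞)) atTop).toNNReal

/-- Evaluation is jointly measurable because `ℚ` is countable, and a limsup, unlike a limit, is
defined on every path. On continuous paths it returns the true value. -/
theorem measurable_pathValue : Measurable fun p : (ℚ → ℝ≥0) × ℝ => pathValue p.1 p.2 := by
  have h1 : Measurable fun p : (ℚ → ℝ≥0) × ℚ => p.1 p.2 :=
    measurable_from_prod_countable_left fun q => measurable_pi_apply q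
  refine (Measurable.limsup fun k => ?_).ennreal_toNNReal
  exact (h1.comp (measurable_fst.prodMk
    ((measurable_ratApprox k).comp measurable_snd))).coe_nnreal_ennreal

theorem pathValue_samplePath {Ω : Type*} (δ c : ℝ) {Y : ℝ → Ω → ℝ≥0} {ω : Ω}
    (hY : Continuous fun t => Y t ω) (t : ℝ) :
    pathValue (samplePath δ c Y ω) t = Y ((t + c) * δ) ω := by
  have hcont : Continuous fun t => Y ((t + c) * δ) ω :=
    hY.comp ((continuous_id.add continuous_const).mul continuous_const)
  have h : Tendsto (fun k => (samplePath δ c Y ω (ratApprox k t) : ℝ≥0∞)) atTop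
      (𝓝 (Y ((t + c) * δ) ω : ℝ≥0∞)) := by
    rw [ENNReal.tendsto_coe]
    exact (hcont.tendsto t).comp (tendsto_ratApprox t)
  rw [pathValue, h.limsup_eq, ENNReal.toNNReal_coe]

attribute [irreducible] pathValue

/-- The service offered in one slot, as a function of the interferers and of the rational-time
fading paths. -/
noncomputable def pathService (δ : ℝ) (g : ℝ≥0∞ → ℝ≥0∞) (l : ℝ → ℝ≥0) (R : ℝ) (γ : ℝ≥0)
    (p : (ℕ → Plane) × (ℕ → ℚ → ℝ≥0)) : ℝ≥0∞ :=
  ∫⁻ t in Set.Ioc 0 δ, g (sinr l R γ p.1 fun j => pathValue (p.2 j) (t / δ))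

variable {δ : ℝ} {g : ℝ≥0∞ → ℝ≥0∞} {l : ℝ → ℝ≥0} {R : ℝ} {γ : ℝ≥0}

theorem measurable_pathService_integrand (hg : Measurable g) (hl : Measurable l) :
    Measurable fun q : ((ℕ → Plane) × (ℕ → ℚ → ℝ≥0)) × ℝ =>
      g (sinr l R γ q.1.1 fun j => pathValue (q.1.2 j) (q.2 / δ)) := by
  have hgs : Measurable fun p : (ℕ → Plane) × (ℕ → ℝ≥0) => g (sinr l R γ p.1 p.2) :=
    hg.comp (measurable_sinr hl R γ)
  have hj : ∀ j, Measurable fun q : ((ℕ → Plane) × (ℕ → ℚ → ℝ≥0)) × ℝ => q.1.2 j := fun j =>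
    (measurable_pi_apply j).comp (measurable_snd.comp measurable_fst)
  have hpath : ∀ j, Measurable fun q : ((ℕ → Plane) × (ℕ → ℚ → ℝ≥0)) × ℝ =>
      pathValue (q.1.2 j) (q.2 / δ) := fun j => by
    have hpr : Measurable fun q : ((ℕ → Plane) × (ℕ → ℚ → ℝ≥0)) × ℝ => (q.1.2 j, q.2 / δ) :=
      (hj j).prodMk (measurable_snd.div_const δ)
    exact measurable_pathValue.comp hpr
  have hpair : Measurable fun q : ((ℕ → Plane) × (ℕ → ℚ → ℝ≥0)) × ℝ =>
      (q.1.1, fun j => pathValue (q.1.2 j) (q.2 / δ)) :=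
    (measurable_fst.comp measurable_fst).prodMk (measurable_pi_lambda _ hpath)
  exact hgs.comp hpair

theorem measurable_pathService (hg : Measurable g) (hl : Measurable l) :
    Measurable (pathService δ g l R γ) :=
  (measurable_pathService_integrand hg hl).lintegral_prod_right'

variable {Ω : Type*} [MeasurableSpace Ω]

omit [MeasurableSpace Ω] in
theorem pathService_samplePath (hδ : 0 < δ) {F : ℕ → ℝ → Ω → ℝ≥0} {ω : Ω}
    (hF : ∀ j, Continuous fun t => F j t ω) (x : ℕ → Plane) (c : ℝ) :
    pathService δ g l R γ (x, fun j => samplePath δ c (F j) ω) =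
      ∫⁻ t in Set.Ioc 0 δ, g (sinr l R γ x fun j => F j (t + c * δ) ω) := by
  simp only [pathService, pathValue_samplePath δ c (hF _)]
  refine lintegral_congr fun t => ?_
  rw [add_mul, div_mul_cancel₀ _ hδ.ne']

omit [MeasurableSpace Ω] in
theorem slotService_eq_pathService (hδ : 0 < δ) {X : ℕ → Ω → Plane} {F : ℕ → ℝ → Ω → ℝ≥0} {ω : Ω}
    (hF : ∀ j, Continuous fun t => F j t ω) (n : ℤ) :
    slotService δ (serviceRate g l R γ X F) n ω =
      pathService δ g l R γ (fun j => X j ω, fun j => samplePath δ n (F j) ω) := by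
  rw [pathService_samplePath hδ hF, slotService, ← lintegral_indicator measurableSet_Ioc,
    ← lintegral_indicator measurableSet_Ioc, ← lintegral_add_right_eq_self _ (n * δ)]
  refine lintegral_congr fun t => ?_
  have hmem : t + n * δ ∈ Set.Ioc (n * δ) ((n + 1) * δ) ↔ t ∈ Set.Ioc 0 δ := by
    simp only [Set.mem_Ioc]
    constructor <;> rintro ⟨h1, h2⟩ <;> constructor <;> linarith
  by_cases h : t ∈ Set.Ioc 0 δ
  · rw [Set.indicator_of_mem h, Set.indicator_of_mem (hmem.2 h)]
    rfl
  · rw [Set.indicator_of_notMem h, Set.indicator_of_notMem (hmem.not.2 h)]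

end Path

/-! ### Ergodic averages of the service with frozen interferers. -/

section Averages

variable {Ω : Type*} [MeasurableSpace Ω] {P : Measure Ω} [IsProbabilityMeasure P]
  {F : ℕ → ℝ → Ω → ℝ≥0}

omit [IsProbabilityMeasure P] in
theorem IsStationary.map_apply_eq {Y : ℝ → Ω → ℝ≥0} (hY : ∀ t, Measurable (Y t))
    (h : IsStationary P Y) (t : ℝ) : P.map (Y t) = P.map (Y 0) := by
  have h1 := congrArg (Measure.map fun z : ℝ → ℝ≥0 => z 0) (h t)
  rw [Measure.map_map (measurable_pi_apply 0) (measurable_pi_lambda _ fun t => hY _),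
    Measure.map_map (measurable_pi_apply 0) (measurable_pi_lambda _ fun t => hY _)] at h1
  simpa [Function.comp_def] using h1

-- By independence the joint law is the product of its marginals, so stationarity of each process
-- gives stationarity of the whole family.
omit [IsProbabilityMeasure P] in
theorem map_fading_eq (hF : ∀ j t, Measurable (F j t)) (hFstat : ∀ j, IsStationary P (F j))
    (hFindep : iIndepFun (fun j ω t => F j t ω) P) (t : ℝ) :
    P.map (fun ω j => F j t ω) = P.map (fun ω j => F j 0 ω) := by
  have h : ∀ t, P.map (fun ω j => F j t ω) = Measure.infinitePi fun j => P.map (F j t) := fun t =>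
    (hFindep.comp (fun _ z => z t) fun _ => measurable_pi_apply t).map_fun_eq_infinitePi_map
      fun j => hF j t
  rw [h, h]
  simp only [fun j => (hFstat j).map_apply_eq (hF j) t]

theorem measurable_samplePaths (hF : ∀ j t, Measurable (F j t)) (δ c : ℝ) :
    Measurable fun ω j => samplePath δ c (F j) ω :=
  measurable_pi_lambda _ fun j => measurable_samplePath (hF j) δ c

omit [IsProbabilityMeasure P] in
theorem map_samplePaths_eq (hF : ∀ j t, Measurable (F j t)) (hFstat : ∀ j, IsStationary P (F j))
    (hFindep : iIndepFun (fun j ω t => F j t ω) P) (δ c : ℝ) :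
    P.map (fun ω j => samplePath δ c (F j) ω) =
      Measure.infinitePi fun j => P.map (samplePath δ 0 (F j)) := by
  have hr : Measurable fun (z : ℝ → ℝ≥0) (q : ℚ) => z ((q + c) * δ) :=
    measurable_pi_lambda _ fun q => measurable_pi_apply _
  have h := (hFindep.comp (fun _ z (q : ℚ) => z ((q + c) * δ)) fun _ => hr).map_fun_eq_infinitePi_map
    fun j => measurable_samplePath (hF j) δ c
  refine Eq.trans h ?_
  congr 1
  ext1 j
  exact (hFstat j).map_samplePath (hF j) δ c

/-- Translation of all fading paths by one slot. -/
def slotShift (y : ℕ → ℚ → ℝ≥0) : ℕ → ℚ → ℝ≥0 := fun j => unitShift (y j)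

theorem iterate_slotShift_samplePath {Ω : Type*} (F : ℕ → ℝ → Ω → ℝ≥0) (δ c : ℝ) (k : ℕ) (ω : Ω) :
    slotShift^[k] (fun j => samplePath δ c (F j) ω) = fun j => samplePath δ (c - k) (F j) ω := by
  unfold slotShift
  rw [iterate_piMap]
  ext1 j
  exact iterate_unitShift_samplePath δ c (F j) k ω

/-- A product of ergodic shifts may fail to be ergodic; a product of mixing ones is mixing, hence
ergodic. -/
theorem ergodic_slotShift (hF : ∀ j t, Measurable (F j t)) (hFstat : ∀ j, IsStationary P (F j))
    (hFmix : ∀ j, IsStronglyMixing P (F j)) (hFindep : iIndepFun (fun j ω t => F j t ω) P)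
    {δ : ℝ} (hδ : 0 < δ) (c : ℝ) :
    Ergodic slotShift (P.map fun ω j => samplePath δ c (F j) ω) := by
  rw [map_samplePaths_eq hF hFstat hFindep]
  have hp : ∀ j, IsProbabilityMeasure (P.map (samplePath δ 0 (F j))) := fun j =>
    Measure.isProbabilityMeasure_map (measurable_samplePath (hF j) δ 0).aemeasurable
  have hmp := fun j => (hFstat j).measurePreserving_unitShift (hF j) δ
  refine IsMixing.ergodic ?_
    (IsMixing.infinitePi hmp fun j => (hFmix j).isMixing_unitShift (hF j) (hFstat j) hδ)
  refine ⟨measurable_pi_lambda _ fun i => measurable_unitShift.comp (measurable_pi_apply i), ?_⟩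
  refine (Measure.infinitePi_map_pi _ fun i => measurable_unitShift).trans ?_
  simp only [fun i => (hmp i).map_eq]

variable {δ : ℝ} {g : ℝ≥0∞ → ℝ≥0∞} {l : ℝ → ℝ≥0} {R : ℝ} {γ : ℝ≥0}

/-- The mean service per slot, for interferers at the points `x`, is `δ` times the mean rate. -/
theorem lintegral_pathService (hF : ∀ j t, Measurable (F j t))
    (hFcont : ∀ j ω, Continuous fun t => F j t ω) (hFstat : ∀ j, IsStationary P (F j))
    (hFindep : iIndepFun (fun j ω t => F j t ω) P) (hg : Measurable g) (hl : Measurable l)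
    (c : ℝ) (x : ℕ → Plane) :
    ∫⁻ ω, pathService δ g l R γ (x, fun j => samplePath δ c (F j) ω) ∂P =
      ENNReal.ofReal δ * ∫⁻ ω, g (sinr l R γ x fun j => F j 0 ω) ∂P := by
  have hm : Measurable fun z : ℕ → ℝ≥0 => g (sinr l R γ x z) :=
    hg.comp ((measurable_sinr hl R γ).comp measurable_prodMk_left)
  have hmeas : Measurable fun q : Ω × ℝ => g (sinr l R γ x fun j =>
      pathValue (samplePath δ c (F j) q.1) (q.2 / δ)) := by
    have hpair : Measurable fun q : Ω × ℝ =>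
        (((x, fun j => samplePath δ c (F j) q.1), q.2) : ((ℕ → Plane) × (ℕ → ℚ → ℝ≥0)) × ℝ) :=
      (measurable_const.prodMk ((measurable_samplePaths hF δ c).comp measurable_fst)).prodMk
        measurable_snd
    exact (measurable_pathService_integrand hg hl).comp hpair
  simp only [pathService]
  rw [lintegral_lintegral_swap hmeas.aemeasurable]
  have : ∀ t, ∫⁻ ω, g (sinr l R γ x fun j => pathValue (samplePath δ c (F j) ω) (t / δ)) ∂P =
      ∫⁻ ω, g (sinr l R γ x fun j => F j 0 ω) ∂P := fun t => by
    simp only [pathValue_samplePath δ c (hFcont _ _)]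
    have h := map_fading_eq hF hFstat hFindep ((t / δ + c) * δ)
    have h1 := lintegral_map (μ := P) hm (measurable_pi_lambda (fun ω j => F j ((t / δ + c) * δ) ω)
      fun j => hF j _)
    have h2 := lintegral_map (μ := P) hm (measurable_pi_lambda (fun ω j => F j 0 ω)
      fun j => hF j 0)
    rw [h] at h1
    exact h1.symm.trans h2
  simp only [this]
  simp [mul_comm]

/-- Given the interferers, the average service in the slots before time `n` converges in `L¹` to
its conditional mean. -/
theorem tendsto_lintegral_slotService_average {X : ℕ → Ω → Plane} (hX : ∀ j, Measurable (X j))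
    (hF : ∀ j t, Measurable (F j t))
    (hFcont : ∀ j ω, Continuous fun t => F j t ω) (hFstat : ∀ j, IsStationary P (F j))
    (hFmix : ∀ j, IsStronglyMixing P (F j)) (hFindep : iIndepFun (fun j ω t => F j t ω) P)
    (hXF : IndepFun (fun ω j => X j ω) (fun ω j t => F j t ω) P)
    (hg : Measurable g) (hl : Measurable l) (hδ : 0 < δ)
    (hfin : ∫⁻ ω, g (sinr l R γ (fun j => X j ω) fun j => F j 0 ω) ∂P ≠ ∞) (n : ℤ) :
    Tendsto (fun m : ℕ => ∫⁻ ω, ((m : ℝ≥0∞)⁻¹ * ∑ k ∈ Finset.range m,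
      slotService δ (serviceRate g l R γ X F) (n - 1 - k) ω - ENNReal.ofReal δ *
        ∫⁻ ω', g (sinr l R γ (fun j => X j ω) fun j => F j 0 ω') ∂P) ∂P) atTop (𝓝 0) := by
  -- The origin is the most recent slot before time `n`; since the shift runs backwards in time, its
  -- `k`-th iterate reads slot `n - 1 - k`.
  set c : ℝ := n - 1
  set Y : Ω → ℕ → ℚ → ℝ≥0 := fun ω j => samplePath δ c (F j) ω with hYdef
  have hY : Measurable Y := measurable_samplePaths hF δ c
  have hXm : Measurable fun ω j => X j ω := measurable_pi_lambda _ hX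
  set u := pathService δ g l R γ
  have hu : Measurable u := measurable_pathService hg hl
  have hux : ∀ x, Measurable fun y => u (x, y) := fun x => hu.comp measurable_prodMk_left
  set v : (ℕ → Plane) → ℝ≥0∞ := fun x =>
    ENNReal.ofReal δ * ∫⁻ ω', g (sinr l R γ x fun j => F j 0 ω') ∂P with hv
  have hZm : Measurable fun ω j => F j 0 ω := measurable_pi_lambda _ fun j => hF j 0
  have hgs : Measurable fun p : (ℕ → Plane) × (ℕ → ℝ≥0) => g (sinr l R γ p.1 p.2) :=
    hg.comp (measurable_sinr hl R γ)
  have hvm : Measurable v := Measurable.const_mul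
    (hgs.comp (measurable_fst.prodMk (hZm.comp measurable_snd))).lintegral_prod_right' _
  have hXY : IndepFun (fun ω j => X j ω) Y P := by
    refine hXF.comp measurable_id (ψ := fun z j (q : ℚ) => z j ((q + c) * δ)) ?_
    exact measurable_pi_lambda _ fun j => measurable_pi_lambda _ fun q =>
      (measurable_pi_apply _).comp (measurable_pi_apply j)
  have hXZ : IndepFun (fun ω j => X j ω) (fun ω j => F j 0 ω) P := by
    refine hXF.comp measurable_id (ψ := fun z j => z j 0) ?_
    exact measurable_pi_lambda _ fun j => (measurable_pi_apply _).comp (measurable_pi_apply j)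
  have hvfin : ∫⁻ ω, v (fun j => X j ω) ∂P ≠ ∞ := by
    have h1 := lintegral_comp_of_indepFun hXm hZm hXZ hgs
    have h2 : Measurable fun x : ℕ → Plane => ∫⁻ ω', g (sinr l R γ x fun j => F j 0 ω') ∂P :=
      (hgs.comp (measurable_fst.prodMk (hZm.comp measurable_snd))).lintegral_prod_right'
    have h3 : ∫⁻ ω, v (fun j => X j ω) ∂P = ENNReal.ofReal δ * _ :=
      lintegral_const_mul _ (h2.comp hXm)
    rw [h3]
    exact ENNReal.mul_ne_top ENNReal.ofReal_ne_top (h1 ▸ hfin)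
  have hT := ergodic_slotShift hF hFstat hFmix hFindep hδ c
  have hprob : IsProbabilityMeasure (P.map Y) := Measure.isProbabilityMeasure_map hY.aemeasurable
  have hmean : ∀ x, ∫⁻ y, u (x, y) ∂(P.map Y) = v x := fun x => by
    rw [lintegral_map (hux x) hY]
    exact lintegral_pathService hF hFcont hFstat hFindep hg hl c x
  have hH : ∀ m : ℕ, Measurable fun p : (ℕ → Plane) × (ℕ → ℚ → ℝ≥0) =>
      orbitAverage slotShift (fun y => u (p.1, y)) m p.2 - v p.1 := fun m => by
    refine Measurable.sub ?_ (hvm.comp measurable_fst)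
    refine Measurable.const_mul (Finset.measurable_fun_sum _ fun k _ => ?_) _
    exact hu.comp (measurable_fst.prodMk ((hT.measurable.iterate k).comp measurable_snd))
  -- Independence of positions and fading turns the expectation into an iterated integral with
  -- positions frozen inside.
  have hrew : ∀ m : ℕ, ∫⁻ ω, ((m : ℝ≥0∞)⁻¹ * ∑ k ∈ Finset.range m,
      slotService δ (serviceRate g l R γ X F) (n - 1 - k) ω - v fun j => X j ω) ∂P =
      ∫⁻ ω, ∫⁻ y, (orbitAverage slotShift (fun y => u (fun j => X j ω, y)) m y - v fun j => X j ω)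
        ∂(P.map Y) ∂P := fun m => by
    have h1 := lintegral_comp_of_indepFun hXm hY hXY (hH m)
    refine Eq.trans (lintegral_congr fun ω => ?_) (h1.trans (lintegral_congr fun ω => ?_))
    · simp only [orbitAverage, hYdef, iterate_slotShift_samplePath]
      congr 2
      refine Finset.sum_congr rfl fun k _ => ?_
      rw [slotService_eq_pathService hδ (hFcont · ω)]
      push_cast
      rfl
    · exact (lintegral_map ((hH m).comp measurable_prodMk_left) hY).symm
  simp only [hv] at hrew
  simp only [hrew]
  -- Dominated convergence over the positions. The excess is at most the average itself, whose mean
  -- for frozen positions `x` is at most `v x`, and `v` is integrable.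
  have hlim := tendsto_lintegral_of_dominated_convergence (μ := P) (f := fun _ => 0)
    (F := fun (m : ℕ) ω => ∫⁻ y, (orbitAverage slotShift (fun y => u (fun j => X j ω, y)) m y -
      v fun j => X j ω) ∂(P.map Y)) (fun ω => v fun j => X j ω)
    (fun m => ((hH m).lintegral_prod_right' (ν := P.map Y)).comp hXm) (fun m => ae_of_all _ fun ω => ?_)
    hvfin ?_
  · simpa using hlim
  · refine (lintegral_mono fun y => tsub_le_self).trans ?_
    rcases eq_or_ne m 0 with rfl | hm
    · simp [orbitAverage]
    · rw [hT.toMeasurePreserving.lintegral_orbitAverage (hux _) hm, hmean]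
  · filter_upwards [ae_lt_top (hvm.comp hXm) hvfin] with ω hω
    have h1 := hT.tendsto_lintegral_orbitAverage (hux fun j => X j ω)
      (by rw [hmean]; exact hω.ne)
    rw [hmean] at h1
    refine tendsto_of_tendsto_of_tendsto_of_le_of_le tendsto_const_nhds h1 (fun _ => zero_le)
      fun m => lintegral_mono fun y => le_self_add

end Averages

/-! ### Ergodic averages of the arrivals. -/

section Arrivals

variable {Ω : Type*} [MeasurableSpace Ω] {P : Measure Ω} [IsProbabilityMeasure P]
  {A : ℤ → Ω → ℝ≥0}

/-- Translation of a sequence by one step, as a measurable equivalence. -/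
def seqShift : (ℤ → ℝ≥0) ≃ᵐ (ℤ → ℝ≥0) where
  toFun a n := a (n + 1)
  invFun a n := a (n - 1)
  left_inv a := by ext1 n; simp
  right_inv a := by ext1 n; simp
  measurable_toFun := measurable_pi_lambda _ fun n => measurable_pi_apply _
  measurable_invFun := measurable_pi_lambda _ fun n => measurable_pi_apply _

theorem iterate_seqShift_symm (k : ℕ) (a : ℤ → ℝ≥0) :
    seqShift.symm^[k] a = fun n => a (n - k) := by
  induction k generalizing a with
  | zero => simp
  | succ k ih =>
    rw [Function.iterate_succ_apply, ih]
    ext1 n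
    change a (n - k - 1) = _
    push_cast
    ring_nf

/-- The average arrivals before time `n` converge in `L¹` to the arrival rate. -/
theorem tendsto_lintegral_arrivals_average (hA : ∀ n, Measurable (A n))
    (hAerg : IsStationaryErgodic P A) {lam : ℝ≥0∞} (hlam : lam ≠ ∞)
    (hrate : ∫⁻ ω, A 0 ω ∂P = lam) (n : ℤ) :
    Tendsto (fun m : ℕ => ∫⁻ ω, (lam - (m : ℝ≥0∞)⁻¹ * ∑ k ∈ Finset.range m,
      (A (n - 1 - k) ω : ℝ≥0∞)) ∂P) atTop (𝓝 0) := by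
  have hAm : Measurable fun ω n => A n ω := measurable_pi_lambda _ hA
  have hprob := Measure.isProbabilityMeasure_map (μ := P) hAm.aemeasurable
  have herg : Ergodic seqShift (P.map fun ω n => A n ω) := hAerg
  have hmeas : ∀ k : ℤ, Measurable fun a : ℤ → ℝ≥0 => (a k : ℝ≥0∞) := fun k =>
    (measurable_pi_apply k).coe_nnreal_ennreal
  have hsucc : ∀ k : ℤ, ∫⁻ ω, A (k + 1) ω ∂P = ∫⁻ ω, A k ω ∂P := fun k => by
    have := herg.toMeasurePreserving.lintegral_comp (hmeas k)
    rw [lintegral_map (hmeas k) hAm] at this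
    exact (lintegral_map ((hmeas k).comp seqShift.measurable) hAm).symm.trans this
  have hmean : ∀ k : ℤ, ∫⁻ ω, A k ω ∂P = lam := fun k => by
    induction k with
    | zero => exact hrate
    | succ k ih => rw [hsucc, ih]
    | pred k ih => rw [← ih, ← hsucc, sub_add_cancel]
  have hint : ∫⁻ a, (a (n - 1) : ℝ≥0∞) ∂(P.map fun ω n => A n ω) = lam := by
    rw [lintegral_map (hmeas _) hAm, hmean]
  -- The sums run into the past, so the ergodic theorem is applied to the inverse shift, which is
  -- ergodic too.
  have h := herg.symm.tendsto_lintegral_orbitAverage (hmeas (n - 1)) (by rwa [hint])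
  rw [hint] at h
  refine tendsto_of_tendsto_of_tendsto_of_le_of_le tendsto_const_nhds h (fun _ => zero_le)
    fun m => ?_
  have horb := measurable_orbitAverage seqShift.symm.measurable (hmeas (n - 1)) m
  refine le_of_le_of_eq ?_
    (lintegral_map (((horb.sub_const lam)).add (measurable_const.sub horb)) hAm).symm
  refine lintegral_mono fun ω => ?_
  simp only [Pi.add_apply, Pi.sub_apply, orbitAverage, iterate_seqShift_symm]
  exact le_add_self

end Arrivals

/-! ### Infinite workload on the bad event. -/

section Unstable

variable {Ω : Type*} [MeasurableSpace Ω] {P : Measure Ω} [IsProbabilityMeasure P]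

/-- Convergence in mean suffices, without a pointwise ergodic theorem: the stationary workload is a
supremum, so a random subsequence of good horizons is enough. -/
theorem ae_stationaryWorkload_eq_top
    {X : ℕ → Ω → Plane} (hX : ∀ j, Measurable (X j))
    (hXord : ∀ᵐ ω ∂P, Monotone fun j => ‖X j ω‖)
    {F : ℕ → ℝ → Ω → ℝ≥0} (hF : ∀ j t, Measurable (F j t))
    (hFcont : ∀ j ω, Continuous fun t => F j t ω)
    (hFstat : ∀ j, IsStationary P (F j)) (hFmix : ∀ j, IsStronglyMixing P (F j))
    (hFindep : iIndepFun (fun j ω t => F j t ω) P)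
    (hXF : IndepFun (fun ω j => X j ω) (fun ω j t => F j t ω) P)
    {l : ℝ → ℝ≥0} (hl : Measurable l) {R : ℝ} {γ : ℝ≥0}
    {g : ℝ≥0∞ → ℝ≥0∞} (hg : Measurable g)
    (hfin : ∫⁻ ω, g (sinr l R γ (fun j => X j ω) fun j => F j 0 ω) ∂P ≠ ∞)
    {δ : ℝ} (hδ : 0 < δ)
    {A : ℤ → Ω → ℝ≥0} (hA : ∀ n, Measurable (A n)) (hAerg : IsStationaryErgodic P A)
    {lam : ℝ≥0} (hrate : ∫⁻ ω, A 0 ω ∂P = lam) :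
    ∀ᵐ ω ∂P, ω ∈ badEvent P X (serviceRate g l R γ X F) δ lam →
      ∀ n : ℤ, stationaryWorkload (fun k => (A k ω : ℝ≥0∞))
        (fun k => slotService δ (serviceRate g l R γ X F) k ω) n = ∞ := by
  have hXm : Measurable fun ω j => X j ω := measurable_pi_lambda _ hX
  have hZm : Measurable fun ω j => F j 0 ω := measurable_pi_lambda _ fun j => hF j 0
  have hXZ : IndepFun (fun ω j => X j ω) (fun ω j => F j 0 ω) P := by
    refine hXF.comp measurable_id (ψ := fun z j => z j 0) ?_
    exact measurable_pi_lambda _ fun j => (measurable_pi_apply _).comp (measurable_pi_apply j)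
  have hgs : Measurable fun p : (ℕ → Plane) × (ℕ → ℝ≥0) => g (sinr l R γ p.1 p.2) :=
    hg.comp (measurable_sinr hl R γ)
  have hcond := condLExp_countingMeasure_ae_eq hX hXord hZm hXZ hgs
    (fun x x' z h => by rw [sinr_congr_norm h])
  have hslot : ∀ k : ℤ, Measurable fun ω => slotService δ (serviceRate g l R γ X F) k ω := by
    intro k
    simp only [fun ω => slotService_eq_pathService (g := g) (l := l) (R := R) (γ := γ) (X := X) hδ
      (hFcont · ω) k]
    exact (measurable_pathService hg hl).comp (hXm.prodMk (measurable_samplePaths hF δ k))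
  have hv : Measurable fun ω => ENNReal.ofReal δ *
      ∫⁻ ω', g (sinr l R γ (fun j => X j ω) fun j => F j 0 ω') ∂P :=
    Measurable.const_mul ((hgs.comp (measurable_fst.prodMk
      (hZm.comp measurable_snd))).lintegral_prod_right'.comp hXm) _
  have hlimn : ∀ n : ℤ, ∀ᵐ ω ∂P, liminf (fun m : ℕ => ((m : ℝ≥0∞)⁻¹ * ∑ k ∈ Finset.range m,
      slotService δ (serviceRate g l R γ X F) (n - 1 - k) ω - ENNReal.ofReal δ *
        ∫⁻ ω', g (sinr l R γ (fun j => X j ω) fun j => F j 0 ω') ∂P) +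
      (lam - (m : ℝ≥0∞)⁻¹ * ∑ k ∈ Finset.range m, (A (n - 1 - k) ω : ℝ≥0∞))) atTop = 0 := by
    intro n
    have h1 := tendsto_lintegral_slotService_average hX hF hFcont hFstat hFmix hFindep hXF hg hl hδ
      hfin n
    have h2 := tendsto_lintegral_arrivals_average hA hAerg ENNReal.coe_ne_top hrate n
    have hm1 : ∀ m : ℕ, Measurable fun ω => (m : ℝ≥0∞)⁻¹ * ∑ k ∈ Finset.range m,
        slotService δ (serviceRate g l R γ X F) (n - 1 - k) ω - ENNReal.ofReal δ *
        ∫⁻ ω', g (sinr l R γ (fun j => X j ω) fun j => F j 0 ω') ∂P := fun m =>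
      ((Finset.measurable_fun_sum _ fun k _ => hslot _).const_mul _).sub hv
    have hm2 : ∀ m : ℕ, Measurable fun ω => (lam : ℝ≥0∞) - (m : ℝ≥0∞)⁻¹ * ∑ k ∈ Finset.range m,
        (A (n - 1 - k) ω : ℝ≥0∞) := fun m =>
      ((Finset.measurable_fun_sum _ fun k _ => (hA _).coe_nnreal_ennreal).const_mul _).const_sub _
    have h3 := h1.add h2
    simp only [← lintegral_add_left (hm1 _), add_zero] at h3
    have hmeas : Measurable fun ω => liminf (fun m : ℕ => ((m : ℝ≥0∞)⁻¹ * ∑ k ∈ Finset.range m,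
      slotService δ (serviceRate g l R γ X F) (n - 1 - k) ω - ENNReal.ofReal δ *
        ∫⁻ ω', g (sinr l R γ (fun j => X j ω) fun j => F j 0 ω') ∂P) +
      (lam - (m : ℝ≥0∞)⁻¹ * ∑ k ∈ Finset.range m, (A (n - 1 - k) ω : ℝ≥0∞))) atTop :=
      Measurable.liminf fun m => (hm1 m).add (hm2 m)
    -- Fatou applied to the sum of the two errors, so that one subsequence serves both.
    refine (lintegral_eq_zero_iff hmeas).1 (le_antisymm ?_ zero_le)
    refine (lintegral_liminf_le fun m => (hm1 m).add (hm2 m)).trans ?_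
    exact h3.liminf_eq.le
  filter_upwards [ae_all_iff.2 hlimn, hcond] with ω hω hc hbad n
  refine stationaryWorkload_eq_top ENNReal.coe_ne_top ?_ (hω n)
  have hbad' : ENNReal.ofReal δ * (P⁻[serviceRate g l R γ X F 0 | MeasurableSpace.comap
    (fun ω' => countingMeasure fun j => X j ω') inferInstance]) ω < lam := hbad
  rw [← hc]
  exact hbad'

end Unstable

/-! ### A region of positive area where the path loss is bounded below. -/

section PathLoss

/-- The sets where `0 < r < n + 1` and `l r ≥ 1 / (n + 1)` exhaust the part of the half-line where
`l` is nonzero, so they cannot all be null. -/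
theorem exists_measurableSet_pathLoss_ge {l : ℝ → ℝ≥0} (hl : Measurable l)
    (hlnz : ¬ ∀ᵐ r ∂(volume.restrict (Set.Ioi (0 : ℝ))), l r = 0) :
    ∃ (b : ℝ) (ε : ℝ≥0) (S : Set ℝ), 0 < b ∧ 0 < ε ∧ MeasurableSet S ∧ S ⊆ Set.Ioo 0 b ∧
      (∀ r ∈ S, ε ≤ l r) ∧ volume S ≠ 0 := by
  by_contra! hcon
  apply hlnz
  set S : ℕ → Set ℝ := fun n => Set.Ioo 0 (n + 1 : ℝ) ∩ l ⁻¹' Set.Ici (1 / (n + 1 : ℝ≥0))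
  have hS : ∀ n, volume (S n) = 0 := fun n =>
    hcon (n + 1) (1 / (n + 1 : ℝ≥0)) (S n) (by positivity) (by positivity)
      (measurableSet_Ioo.inter (hl measurableSet_Ici)) Set.inter_subset_left fun r hr => hr.2
  rw [ae_restrict_iff' measurableSet_Ioi]
  refine measure_mono_null (fun r hr => ?_) (measure_iUnion_null hS)
  simp only [Set.mem_compl_iff, Set.mem_ofPred_eq, Classical.not_imp, Set.mem_Ioi] at hr
  obtain ⟨hr0, hlr⟩ := hr
  obtain ⟨n₁, hn₁⟩ := exists_nat_gt r
  obtain ⟨n₂, hn₂⟩ := exists_nat_one_div_lt (pos_iff_ne_zero.2 hlr)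
  refine Set.mem_iUnion.2 ⟨max n₁ n₂, ⟨hr0, hn₁.trans_le ?_⟩, ?_⟩
  · exact (Nat.cast_le.2 (le_max_left n₁ n₂)).trans (by linarith)
  · refine le_trans ?_ hn₂.le
    have : (n₂ : ℝ≥0) ≤ (max n₁ n₂ : ℕ) := Nat.cast_le.2 (le_max_right n₁ n₂)
    gcongr

/-- In polar coordinates the area is a positive constant times the integral over `S` of the weight
`r`, which is positive on `S`. -/
theorem volume_setOf_norm_mem_ne_zero {S : Set ℝ} (hS : MeasurableSet S) {b : ℝ}
    (hSb : S ⊆ Set.Ioo 0 b) (h : volume S ≠ 0) : volume {y : Plane | ‖y‖ ∈ S} ≠ 0 := by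
  intro h0
  apply h
  set f : ℝ → ℝ := S.indicator fun _ => 1
  have hCm : MeasurableSet {y : Plane | ‖y‖ ∈ S} := measurable_norm hS
  have hf : (fun y : Plane => f ‖y‖) = {y : Plane | ‖y‖ ∈ S}.indicator fun _ => 1 := by
    ext y
    by_cases hy : ‖y‖ ∈ S
    · rw [Set.indicator_of_mem (show y ∈ {y : Plane | ‖y‖ ∈ S} from hy)]; exact Set.indicator_of_mem hy _
    · rw [Set.indicator_of_notMem (show y ∉ {y : Plane | ‖y‖ ∈ S} from hy)]
      exact Set.indicator_of_notMem hy _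
  have hae : (fun y : Plane => f ‖y‖) =ᵐ[volume] 0 := by
    rw [hf]
    exact indicator_meas_zero h0
  have hI := integral_fun_norm_addHaar (volume : Measure Plane) f
  have hint : Integrable fun y : Plane => f ‖y‖ := (integrable_zero _ _ _).congr hae.symm
  rw [integrable_fun_norm_addHaar] at hint
  rw [integral_congr_ae hae] at hI
  have hb : (volume : Measure Plane).real (Metric.ball 0 1) ≠ 0 := by
    rw [measureReal_def, ENNReal.toReal_ne_zero]
    exact ⟨(Metric.measure_ball_pos _ _ one_pos).ne', measure_ball_lt_top.ne⟩
  simp only [Pi.zero_apply, integral_zero, finrank_euclideanSpace, Fintype.card_fin, smul_eq_mul,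
    nsmul_eq_mul, zero_eq_mul] at hI
  have hI' : ∫ y in Set.Ioi (0 : ℝ), y ^ (2 - 1) * f y = 0 := by
    rcases hI with h | h
    · norm_num at h
    · exact (mul_eq_zero.1 h).resolve_left hb
  simp only [finrank_euclideanSpace, Fintype.card_fin, smul_eq_mul] at hint
  rw [setIntegral_eq_zero_iff_of_nonneg_ae ?_ hint] at hI'
  · rw [← Measure.restrict_eq_self volume (hSb.trans Set.Ioo_subset_Ioi_self)]
    refine measure_mono_null (fun r hr => ?_) hI'
    have hr0 := (hSb hr).1
    simp [f, hr, hr0.ne']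
  · filter_upwards [ae_restrict_mem measurableSet_Ioi] with r hr
    exact mul_nonneg (pow_nonneg (le_of_lt hr) _) (Set.indicator_nonneg (fun _ _ => zero_le_one) _)

end PathLoss

/-! ### Independence and positivity for Poisson counts. -/

section Poisson

variable {Ω : Type*} [MeasurableSpace Ω] {P : Measure Ω} {Φ : Ω → Measure Plane}
  {μ : Measure Plane}

theorem IsPoissonProcess.measurable_apply (h : IsPoissonProcess P Φ μ) {B : Set Plane}
    (hB : MeasurableSet B) : Measurable fun ω => Φ ω B :=
  (Measure.measurable_coe hB).comp h.measurable

theorem IsPoissonProcess.iIndepFun_nat (h : IsPoissonProcess P Φ μ) {B : ℕ → Set Plane}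
    (hB : ∀ i, MeasurableSet (B i)) (hbdd : ∀ i, Bornology.IsBounded (B i))
    (hd : Pairwise fun i k => Disjoint (B i) (B k)) : iIndepFun (fun i ω => Φ ω (B i)) P := by
  rw [iIndepFun_iff_measure_inter_preimage_eq_mul]
  intro S sets hsets
  obtain ⟨n, hn⟩ : ∃ n, ∀ m ∈ S, m < n := ⟨S.sup id + 1, fun m hm =>
    Nat.lt_succ_of_le (Finset.le_sup (f := id) hm)⟩
  have hi := h.indep n (fun i => B i) (fun i => hB i) (fun i => hbdd i)
    fun i k hik => hd (Fin.val_ne_of_ne hik)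
  have hS : S = (S.attachFin hn).map Fin.valEmbedding := by
    ext m
    simp only [Finset.mem_map, Finset.mem_attachFin, Fin.valEmbedding_apply]
    exact ⟨fun hm => ⟨⟨m, hn m hm⟩, hm, rfl⟩, fun ⟨a, ha, hm⟩ => hm ▸ ha⟩
  have := (iIndepFun_iff_measure_inter_preimage_eq_mul.1 hi) (S.attachFin hn)
    (sets := fun i => sets i) fun i hiS => hsets i (by simpa using hiS)
  have hinter : (⋂ i ∈ S, (fun ω => Φ ω (B i)) ⁻¹' sets i) =
      ⋂ i ∈ S.attachFin hn, (fun ω => Φ ω (B i)) ⁻¹' sets i := by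
    ext ω
    simp only [Set.mem_iInter, Finset.mem_attachFin]
    exact ⟨fun h i hi => h i hi, fun h i hi => h ⟨i, hn i hi⟩ hi⟩
  rw [hinter, this]
  conv_rhs => rw [hS, Finset.prod_map]
  rfl

/-- Numbers of points inside a ball are independent of the process outside that ball. -/
theorem IsPoissonProcess.indep_annulus [IsProbabilityMeasure P] (h : IsPoissonProcess P Φ μ)
    {b : ℝ} {C D : Set Plane}
    (hC : MeasurableSet C) (hD : MeasurableSet D) (hCD : Disjoint C D)
    (hCb : C ⊆ Metric.ball 0 b) (hDb : D ⊆ Metric.ball 0 b) :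
    Indep (⨆ (k : ℕ) (i : ℕ), MeasurableSpace.comap (fun ω => Φ ω (annulus b (i / 2 ^ k)))
      inferInstance) (MeasurableSpace.comap (fun ω => (Φ ω C, Φ ω D)) inferInstance) P := by
  have hm1 : ∀ (k i : ℕ), MeasurableSpace.comap (fun ω => Φ ω (annulus b (i / 2 ^ k)))
      inferInstance ≤ ‹MeasurableSpace Ω› := fun k i =>
    (h.measurable_apply (measurableSet_annulus b _)).comap_le
  refine indep_iSup_of_monotone (fun k => ?_) (fun k => iSup_le (hm1 k))
    ((h.measurable_apply hC).prodMk (h.measurable_apply hD)).comap_le ?_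
  -- At a fixed dyadic level, `C`, `D` and the shells of width `2 ^ (-k)` are disjoint, so their
  -- counts are independent, and each annulus is a finite union of shells.
  · set sh : ℕ → Set Plane := fun i => {y | b + i / 2 ^ k ≤ ‖y‖ ∧ ‖y‖ < b + (i + 1) / 2 ^ k} with hsh
    have hshm : ∀ i, MeasurableSet (sh i) := fun i =>
      (measurableSet_le measurable_const measurable_norm).inter
        (measurableSet_lt measurable_norm measurable_const)
    have hpow : (0 : ℝ) < 2 ^ k := by positivity
    have hdisj : ∀ i j, i < j → Disjoint (sh i) (sh j) := by
      intro i j hij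
      rw [Set.disjoint_left]
      rintro y ⟨-, h1⟩ ⟨h2, -⟩
      have : ((i : ℝ) + 1) / 2 ^ k ≤ j / 2 ^ k := by
        have : (i : ℝ) + 1 ≤ j := by exact_mod_cast hij
        gcongr
      linarith
    have hin : ∀ E ⊆ Metric.ball (0 : Plane) b, ∀ i, Disjoint E (sh i) := by
      intro E hE i
      rw [Set.disjoint_left]
      rintro y hy ⟨h2, -⟩
      have h1 := mem_ball_zero_iff.1 (hE hy)
      have : 0 ≤ (i : ℝ) / 2 ^ k := by positivity
      linarith
    set B : ℕ → Set Plane := fun i => match i with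
      | 0 => C
      | 1 => D
      | i + 2 => sh i with hBdef
    have hBm : ∀ i, MeasurableSet (B i) := by
      rintro (_ | _ | i)
      exacts [hC, hD, hshm i]
    have hBb : ∀ i, Bornology.IsBounded (B i) := by
      rintro (_ | _ | i)
      · exact Metric.isBounded_ball.subset hCb
      · exact Metric.isBounded_ball.subset hDb
      · refine (Metric.isBounded_ball (x := (0 : Plane)) (r := b + (i + 1) / 2 ^ k)).subset
          fun y hy => mem_ball_zero_iff.2 hy.2
    have hBd : Pairwise fun i k => Disjoint (B i) (B k) := by
      have hlt : ∀ i j, i < j → Disjoint (B i) (B j) := by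
        rintro (_ | _ | i) (_ | _ | j) hij
        · omega
        · exact hCD
        · exact hin C hCb j
        · omega
        · omega
        · exact hin D hDb j
        · omega
        · omega
        · exact hdisj i j (by omega)
      intro i j hij
      rcases lt_or_gt_of_ne hij with h1 | h1
      · exact hlt i j h1
      · exact (hlt j i h1).symm
    have hind := h.iIndepFun_nat hBm hBb hBd
    have hle : ∀ i, MeasurableSpace.comap (fun ω => Φ ω (B i)) inferInstance ≤ ‹MeasurableSpace Ω› :=
      fun i => (h.measurable_apply (hBm i)).comap_le
    have hsplit := indep_iSup_of_disjoint hle hind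
      (S := {i | 2 ≤ i}) (T := {i | i < 2}) (by
        rw [Set.disjoint_left]; intro i h1 h2; simp only [Set.mem_ofPred_eq] at h1 h2; omega)
    refine indep_of_indep_of_le_left (indep_of_indep_of_le_right hsplit ?_) ?_
    · have hproj : ∀ i < 2, Measurable[⨆ i ∈ {i | i < 2}, MeasurableSpace.comap
          (fun ω => Φ ω (B i)) inferInstance] fun ω => Φ ω (B i) := fun i hi =>
        (comap_measurable _).mono (le_iSup₂_of_le i hi le_rfl) le_rfl
      exact ((hproj 0 (by norm_num)).prodMk (hproj 1 (by norm_num))).comap_le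
    · refine iSup_le fun i => ?_
      have hproj : ∀ j, Measurable[⨆ i ∈ {i | 2 ≤ i}, MeasurableSpace.comap
          (fun ω => Φ ω (B i)) inferInstance] fun ω => Φ ω (sh j) := fun j =>
        (comap_measurable fun ω => Φ ω (B (j + 2))).mono
          (le_iSup₂_of_le (j + 2) (by simp) le_rfl) le_rfl
      have hunion : annulus b (i / 2 ^ k) = ⋃ j ∈ Finset.range i, sh j := by
        ext y
        simp only [mem_annulus, Set.mem_iUnion, Finset.mem_range, hsh, Set.mem_ofPred_eq,
          exists_prop]
        constructor
        · rintro ⟨h1, h2⟩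
          have h0 : 0 ≤ (‖y‖ - b) * 2 ^ k := mul_nonneg (by linarith) hpow.le
          refine ⟨⌊(‖y‖ - b) * 2 ^ k⌋₊, ?_, ?_, ?_⟩
          · rw [Nat.floor_lt h0, ← lt_div_iff₀ hpow]
            linarith
          · rw [← le_sub_iff_add_le', div_le_iff₀ hpow]
            exact Nat.floor_le h0
          · rw [← sub_lt_iff_lt_add', lt_div_iff₀ hpow]
            exact Nat.lt_floor_add_one _
        · rintro ⟨j, hj, h1, h2⟩
          have hj0 : 0 ≤ (j : ℝ) / 2 ^ k := by positivity
          have : ((j : ℝ) + 1) / 2 ^ k ≤ i / 2 ^ k := by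
            have : (j : ℝ) + 1 ≤ i := by exact_mod_cast hj
            gcongr
          constructor <;> linarith
      have hsum : (fun ω => Φ ω (annulus b (i / 2 ^ k))) =
          fun ω => ∑ j ∈ Finset.range i, Φ ω (sh j) := by
        ext ω
        rw [hunion, measure_biUnion_finset _ fun j _ => hshm j]
        intro j _ j' _ hne
        rcases lt_or_gt_of_ne hne with h1 | h1
        · exact hdisj j j' h1
        · exact (hdisj j' j h1).symm
      rw [hsum]
      exact (Finset.measurable_fun_sum _ fun j _ => hproj j).comap_le
  -- Halving the mesh keeps every old radius, so the σ-algebras increase with `k`.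
  · refine monotone_nat_of_le_succ fun k => iSup_le fun i => le_iSup_of_le (2 * i) (le_of_eq ?_)
    have : ((2 * i : ℕ) : ℝ) / 2 ^ (k + 1) = i / 2 ^ k := by
      push_cast
      rw [pow_succ]
      field_simp
    rw [this]

theorem IsPoissonProcess.measure_apply_eq (h : IsPoissonProcess P Φ μ) {B : Set Plane}
    (hB : MeasurableSet B) (hb : Bornology.IsBounded B) (N : ℕ) :
    P {ω | Φ ω B = N} = poissonMeasure (μ B).toNNReal {N} := by
  have h1 : P.map (fun ω => Φ ω B) {(N : ℝ≥0∞)} = _ :=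
    congrArg (fun ν : Measure ℝ≥0∞ => ν {(N : ℝ≥0∞)}) (h.law B hB hb)
  rw [Measure.map_apply (h.measurable_apply hB) (measurableSet_singleton _),
    Measure.map_apply Measurable.of_discrete (measurableSet_singleton _)] at h1
  have h2 : (Nat.cast : ℕ → ℝ≥0∞) ⁻¹' {(N : ℝ≥0∞)} = {N} := by ext; simp
  rw [h2] at h1
  exact h1

/-- Only `C` needs positive mean: a Poisson variable takes the value `0` with positive probability
whatever its mean. -/
theorem IsPoissonProcess.measure_pos (h : IsPoissonProcess P Φ μ) {C D : Set Plane}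
    (hC : MeasurableSet C) (hD : MeasurableSet D) (hCD : Disjoint C D)
    (hCb : Bornology.IsBounded C) (hDb : Bornology.IsBounded D) (hC0 : μ C ≠ 0) (hCt : μ C ≠ ∞)
    (N : ℕ) : P {ω | Φ ω C = N ∧ Φ ω D = 0} ≠ 0 := by
  have hi := h.indep 2 ![C, D] (by intro i; fin_cases i <;> simpa)
    (by intro i; fin_cases i <;> simpa) (by
      intro i k hik
      fin_cases i <;> fin_cases k
      · exact absurd rfl hik
      · exact hCD
      · exact hCD.symm
      · exact absurd rfl hik)
  have hind := hi.indepFun (show (0 : Fin 2) ≠ 1 by decide)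
  have h1 := hind.measure_inter_preimage_eq_mul {(N : ℝ≥0∞)} {0} (measurableSet_singleton _)
    (measurableSet_singleton _)
  have h2 : {ω | Φ ω C = N ∧ Φ ω D = 0} =
      (fun ω => Φ ω (![C, D] 0)) ⁻¹' {(N : ℝ≥0∞)} ∩ (fun ω => Φ ω (![C, D] 1)) ⁻¹' {0} := by
    ext ω; simp
  rw [h2, h1]
  have h3 := h.measure_apply_eq hC hCb N
  have h4 := h.measure_apply_eq hD hDb 0
  have h3' : P ((fun ω => Φ ω (![C, D] 0)) ⁻¹' {(N : ℝ≥0∞)}) ≠ 0 := by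
    refine ne_of_eq_of_ne h3 ?_
    rw [poissonMeasure_singleton]
    have : 0 < (μ C).toNNReal := ENNReal.toNNReal_pos hC0 hCt
    simp only [ne_eq, ENNReal.ofReal_eq_zero, not_le]
    positivity
  have h4' : P ((fun ω => Φ ω (![C, D] 1)) ⁻¹' {0}) ≠ 0 := by
    have : P ((fun ω => Φ ω (![C, D] 1)) ⁻¹' {0}) = P {ω | Φ ω D = (0 : ℕ)} := by simp; rfl
    rw [this, h4, poissonMeasure_singleton]
    simp only [ne_eq, ENNReal.ofReal_eq_zero, not_le]
    positivity
  exact mul_ne_zero h3' h4'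

end Poisson

/-! ### Sums of i.i.d. fading variables, and renumbering after the near interferers are dropped. -/

section Fading

variable {Ω : Type*} [MeasurableSpace Ω] {P : Measure Ω} [IsProbabilityMeasure P]

/-- Sums of many independent copies of a variable that is not a.s. zero are large. -/
theorem tendsto_measure_sum_le {W : ℕ → Ω → ℝ≥0} (hW : ∀ j, Measurable (W j))
    (hind : iIndepFun W P) (hident : ∀ j, IdentDistrib (W j) (W 0) P P)
    (hnz : ¬ ∀ᵐ ω ∂P, W 0 ω = 0) (K : ℝ≥0) :
    Tendsto (fun N : ℕ => P {ω | ∑ i ∈ Finset.range N, W i ω ≤ K}) atTop (𝓝 0) := by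
  set w : ℕ → Ω → ℝ := fun j ω => W j ω
  have hw : ∀ j, Measurable (w j) := fun j => (hW j).coe_nnreal_real
  have hwind : iIndepFun w P := hind.comp (fun _ x => (x : ℝ)) fun _ => measurable_coe_nnreal_real
  have hbound : ∀ (u : Ω → ℝ), Measurable u → (∀ ω, 0 ≤ u ω) →
      Integrable (fun ω => Real.exp (-1 * u ω)) P := fun u hu h0 => by
    refine Integrable.of_bound (by fun_prop) 1 (ae_of_all _ fun ω => ?_)
    rw [Real.norm_of_nonneg (Real.exp_nonneg _), Real.exp_le_one_iff]
    linarith [h0 ω]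
  -- Chernoff at `t = -1`: the probability is at most `exp K * q ^ N`, and `q < 1` because `W 0` is
  -- not almost surely zero.
  set q := mgf (w 0) P (-1) with hq
  have hmgf : ∀ j, mgf (w j) P (-1) = q := fun j => by
    exact congrFun (mgf_congr_identDistrib ((hident j).comp measurable_coe_nnreal_real)) (-1)
  have hq0 : 0 ≤ q := mgf_nonneg
  have hq1 : q < 1 := by
    have hint := hbound (w 0) (hw 0) fun ω => (W 0 ω).2
    have hsub : Integrable (fun ω => 1 - Real.exp (-1 * w 0 ω)) P := (integrable_const 1).sub hint
    have hpos : 0 < ∫ ω, (1 - Real.exp (-1 * w 0 ω)) ∂P := by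
      refine (integral_pos_iff_support_of_nonneg (fun ω => ?_) hsub).2 ?_
      · simp only [Pi.zero_apply, sub_nonneg, Real.exp_le_one_iff]
        have : 0 ≤ w 0 ω := (W 0 ω).2
        linarith
      · refine pos_iff_ne_zero.2 fun h0 => hnz ?_
        refine measure_mono_null (fun ω hω => ?_) h0
        simp only [Set.mem_compl_iff, Set.mem_ofPred_eq] at hω
        simp only [Function.mem_support, ne_eq, sub_eq_zero]
        intro h1
        have := (Real.exp_eq_one_iff _).1 h1.symm
        exact hω (by simpa [w] using this)
    rw [integral_sub (integrable_const 1) hint] at hpos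
    simp only [integral_const, probReal_univ, smul_eq_mul, mul_one, sub_pos] at hpos
    exact hpos
  have hle : ∀ N : ℕ, P.real {ω | ∑ i ∈ Finset.range N, W i ω ≤ K} ≤ Real.exp K * q ^ N := by
    intro N
    have hsum : Measurable (∑ i ∈ Finset.range N, w i) :=
      by
      rw [Finset.sum_fn]
      exact Finset.measurable_fun_sum _ fun i _ => hw i
    have h1 := measure_le_le_exp_mul_mgf (μ := P) (X := ∑ i ∈ Finset.range N, w i) (t := -1) K
      (by norm_num) (hbound _ hsum fun ω => by
        rw [Finset.sum_apply]; exact Finset.sum_nonneg fun i _ => (W i ω).2)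
    rw [hwind.mgf_sum hw] at h1
    simp only [hmgf, Finset.prod_const, Finset.card_range] at h1
    have h2 : {ω | ∑ i ∈ Finset.range N, W i ω ≤ K} =
        {ω | (∑ i ∈ Finset.range N, w i) ω ≤ K} := by
      ext ω
      simp only [Set.mem_ofPred_eq, Finset.sum_apply, w]
      rw [← NNReal.coe_le_coe]
      push_cast
      rfl
    rw [h2]
    simpa using h1
  have hlim : Tendsto (fun N : ℕ => Real.exp K * q ^ N) atTop (𝓝 0) := by
    simpa using (tendsto_pow_atTop_nhds_zero_of_lt_one hq0 hq1).const_mul (Real.exp K)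
  have := squeeze_zero (fun _ => measureReal_nonneg) hle hlim
  rw [← ENNReal.tendsto_toReal_iff (fun _ => measure_ne_top _ _) ENNReal.zero_ne_top]
  simpa [measureReal_def] using this

/-- Removal of the fading variables of the first `N` interferers. -/
def dropInterferers (N : ℕ) (f : ℕ → ℝ≥0) : ℕ → ℝ≥0
  | 0 => f 0
  | j + 1 => f (N + j + 1)

theorem measurable_dropInterferers (N : ℕ) : Measurable (dropInterferers N) := by
  refine measurable_pi_lambda _ fun j => ?_
  cases j with
  | zero => exact measurable_pi_apply 0
  | succ j => exact measurable_pi_apply (N + j + 1)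

-- Dropping is an injective renumbering that fixes index `0` and permits only equally distributed
-- replacements; this makes the later bounds uniform in `N`.
omit [IsProbabilityMeasure P] in
theorem map_dropInterferers {Z : ℕ → Ω → ℝ≥0} (hZ : ∀ j, Measurable (Z j)) (hind : iIndepFun Z P)
    (hident : ∀ j, IdentDistrib (Z (j + 1)) (Z 1) P P) (N : ℕ) :
    P.map (fun ω => dropInterferers N fun j => Z j ω) = P.map fun ω j => Z j ω := by
  set σ : ℕ → ℕ := fun j => match j with
    | 0 => 0
    | j + 1 => N + j + 1 with hσ
  have hσinj : Function.Injective σ := by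
    rintro (_ | i) (_ | j) h
    · rfl
    · simp only [hσ] at h; omega
    · simp only [hσ] at h; omega
    · simp only [hσ] at h; omega
  have h1 : (fun ω => dropInterferers N fun j => Z j ω) = fun ω j => Z (σ j) ω := by
    ext ω j
    cases j <;> rfl
  rw [h1, (hind.precomp hσinj).map_fun_eq_infinitePi_map fun j => hZ (σ j),
    hind.map_fun_eq_infinitePi_map hZ]
  congr 1
  ext1 j
  cases j with
  | zero => rfl
  | succ j => exact (hident (N + j)).map_eq.trans (hident j).map_eq.symm

omit [IsProbabilityMeasure P] in
theorem indepFun_dropInterferers {Z : ℕ → Ω → ℝ≥0} (hZ : ∀ j, Measurable (Z j))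
    (hind : iIndepFun Z P) (N : ℕ) :
    IndepFun (fun ω => dropInterferers N fun j => Z j ω)
      (fun ω => ∑ i ∈ Finset.range N, Z (i + 1) ω) P := by
  set S : Set ℕ := {j | j = 0 ∨ N < j}
  set T : Set ℕ := {j | 1 ≤ j ∧ j ≤ N}
  have hsplit := indep_iSup_of_disjoint (fun j => (hZ j).comap_le) hind (S := S) (T := T) (by
    rw [Set.disjoint_left]
    rintro j h1 ⟨h2, h3⟩
    rcases h1 with h1 | h1 <;> omega)
  have hproj : ∀ (U : Set ℕ), ∀ j ∈ U, Measurable[⨆ j ∈ U, MeasurableSpace.comap (Z j)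
      inferInstance] (Z j) := fun U j hj =>
    (comap_measurable _).mono (le_iSup₂_of_le j hj le_rfl) le_rfl
  refine indep_of_indep_of_le_left (indep_of_indep_of_le_right hsplit ?_) ?_
  · refine Measurable.comap_le ?_
    exact Finset.measurable_fun_sum _ fun i hi => hproj T (i + 1)
      ⟨by omega, by have := Finset.mem_range.1 hi; omega⟩
  · refine Measurable.comap_le (@measurable_pi_lambda Ω ℕ (fun _ => ℝ≥0)
      (⨆ j ∈ S, MeasurableSpace.comap (Z j) inferInstance) _ _ fun j => ?_)
    cases j with
    | zero => exact hproj S 0 (Or.inl rfl)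
    | succ j => exact hproj S (N + j + 1) (Or.inr (by omega))

end Fading

/-! ### Pointwise bounds on the SINR and the rate with `N` near interferers. -/

section NearInterferers

theorem interference_eq_add {l : ℝ → ℝ≥0} {x y : ℕ → Plane} {N : ℕ}
    (hy : ∀ j, ‖y j‖ = ‖x (N + j)‖) (f : ℕ → ℝ≥0) :
    interference l x f = ∑ i ∈ Finset.range N, (l ‖x i‖ : ℝ≥0∞) * f (i + 1) +
      interference l y (dropInterferers N f) := by
  rw [interference, ← (ENNReal.summable).sum_add_tsum_nat_add' (k := N)]
  congr 1
  refine tsum_congr fun j => ?_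
  rw [hy, add_comm j N]
  rfl

theorem sinr_le_sinr_dropInterferers {l : ℝ → ℝ≥0} {R : ℝ} {γ : ℝ≥0} {x y : ℕ → Plane} {N : ℕ}
    (hy : ∀ j, ‖y j‖ = ‖x (N + j)‖) (f : ℕ → ℝ≥0) :
    sinr l R γ x f ≤ sinr l R γ y (dropInterferers N f) := by
  rw [sinr, sinr, interference_eq_add hy]
  refine ENNReal.div_le_div le_rfl ?_
  gcongr
  exact le_add_self

theorem sinr_le_div_sum {l : ℝ → ℝ≥0} {R : ℝ} {γ : ℝ≥0} {x y : ℕ → Plane} {N : ℕ}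
    (hy : ∀ j, ‖y j‖ = ‖x (N + j)‖) {ε : ℝ≥0} (hε : ∀ i < N, ε ≤ l ‖x i‖) (f : ℕ → ℝ≥0) :
    sinr l R γ x f ≤ ((l R : ℝ≥0∞) * f 0) / (ε * ∑ i ∈ Finset.range N, (f (i + 1) : ℝ≥0∞)) := by
  rw [sinr, interference_eq_add hy, Finset.mul_sum]
  refine ENNReal.div_le_div le_rfl ?_
  refine le_trans ?_ (le_self_add.trans le_self_add)
  refine Finset.sum_le_sum fun i hi => ?_
  gcongr
  exact hε i (Finset.mem_range.1 hi)

/-- If the signal fading is at most `M` and the near fading sum exceeds `K`, the choice of `K`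
forces the SINR below `θ`, hence the rate below `e`. Otherwise the near interferers are discarded,
which raises the SINR, and monotonicity of `h` applies. -/
theorem rate_le_add_indicators {g h : ℝ≥0∞ → ℝ≥0∞} (hmono : Monotone h) (hgh : ∀ x, g x ≤ h x)
    {l : ℝ → ℝ≥0} {R : ℝ} {γ : ℝ≥0} {x y : ℕ → Plane} {N : ℕ}
    (hy : ∀ j, ‖y j‖ = ‖x (N + j)‖) {ε : ℝ≥0} (hε : ∀ i < N, ε ≤ l ‖x i‖)
    {e : ℝ≥0∞} {θ M K : ℝ≥0} (hθ : ∀ u ≤ (θ : ℝ≥0∞), g u ≤ e) (hK : θ * (ε * K) = l R * M)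
    (z : ℕ → ℝ≥0) :
    g (sinr l R γ x z) ≤ e +
      {z : ℕ → ℝ≥0 | M < z 0}.indicator (fun z => h (sinr l R γ y (dropInterferers N z))) z +
      {z : ℕ → ℝ≥0 | ∑ i ∈ Finset.range N, z (i + 1) ≤ K}.indicator
        (fun z => h (sinr l R γ y (dropInterferers N z))) z := by
  have hg1 : g (sinr l R γ x z) ≤ h (sinr l R γ y (dropInterferers N z)) :=
    (hgh _).trans (hmono (sinr_le_sinr_dropInterferers hy _))
  by_cases h1 : M < z 0
  · rw [Set.indicator_of_mem (show z ∈ {z : ℕ → ℝ≥0 | M < z 0} from h1)]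
    exact hg1.trans (le_add_self.trans le_self_add)
  by_cases h2 : ∑ i ∈ Finset.range N, z (i + 1) ≤ K
  · rw [Set.indicator_of_mem (show z ∈ {z : ℕ → ℝ≥0 | ∑ i ∈ Finset.range N, z (i + 1) ≤ K} from h2)]
    exact hg1.trans le_add_self
  refine le_trans (hθ _ ?_) (le_self_add.trans le_self_add)
  refine (sinr_le_div_sum hy hε z).trans (ENNReal.div_le_of_le_mul ?_)
  have h3 : l R * z 0 ≤ θ * (ε * ∑ i ∈ Finset.range N, z (i + 1)) := by
    calc l R * z 0 ≤ l R * M := by gcongr; exact not_lt.1 h1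
      _ = θ * (ε * K) := hK.symm
      _ ≤ _ := by gcongr; exact (not_le.1 h2).le
  exact_mod_cast h3

end NearInterferers

/-! ### Integrals of the two exceptional terms. -/

section DropInterferers

variable {Ω : Type*} [MeasurableSpace Ω] {P : Measure Ω}

theorem lintegral_comp_dropInterferers {Z : ℕ → Ω → ℝ≥0} (hZ : ∀ j, Measurable (Z j))
    (hind : iIndepFun Z P) (hident : ∀ j, IdentDistrib (Z (j + 1)) (Z 1) P P) (N : ℕ)
    {H : (ℕ → ℝ≥0) → ℝ≥0∞} (hH : Measurable H) :
    ∫⁻ ω, H (dropInterferers N fun j => Z j ω) ∂P = ∫⁻ ω, H (fun j => Z j ω) ∂P := by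
  have hZm : Measurable fun ω j => Z j ω := measurable_pi_lambda _ hZ
  rw [← lintegral_map hH hZm, ← map_dropInterferers hZ hind hident N]
  exact (lintegral_map hH ((measurable_dropInterferers N).comp hZm)).symm

/-- The signal fading is not independent of the far SINR, so this term does not factor; but dropping
fixes index `0`, so the whole integrand is a function of the renumbered sequence. -/
theorem lintegral_indicator_fading_dropInterferers {Z : ℕ → Ω → ℝ≥0} (hZ : ∀ j, Measurable (Z j))
    (hind : iIndepFun Z P) (hident : ∀ j, IdentDistrib (Z (j + 1)) (Z 1) P P) (N : ℕ)
    {H : (ℕ → ℝ≥0) → ℝ≥0∞} (hH : Measurable H) (M : ℝ≥0) :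
    ∫⁻ ω, {z : ℕ → ℝ≥0 | M < z 0}.indicator (fun z => H (dropInterferers N z))
      (fun j => Z j ω) ∂P =
      ∫⁻ ω, {z : ℕ → ℝ≥0 | M < z 0}.indicator H (fun j => Z j ω) ∂P := by
  have hB : MeasurableSet {z : ℕ → ℝ≥0 | M < z 0} :=
    measurableSet_lt measurable_const (measurable_pi_apply 0)
  exact lintegral_comp_dropInterferers hZ hind hident N (hH.indicator hB)

/-- The near sum and the renumbered sequence use disjoint sets of indices, so the integral factors.
-/
theorem lintegral_indicator_sum_dropInterferers {Z : ℕ → Ω → ℝ≥0} (hZ : ∀ j, Measurable (Z j))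
    (hind : iIndepFun Z P) (hident : ∀ j, IdentDistrib (Z (j + 1)) (Z 1) P P) (N : ℕ)
    {H : (ℕ → ℝ≥0) → ℝ≥0∞} (hH : Measurable H) (K : ℝ≥0) :
    ∫⁻ ω, {z : ℕ → ℝ≥0 | ∑ i ∈ Finset.range N, z (i + 1) ≤ K}.indicator
        (fun z => H (dropInterferers N z)) (fun j => Z j ω) ∂P =
      (∫⁻ ω, H (fun j => Z j ω) ∂P) * P {ω | ∑ i ∈ Finset.range N, Z (i + 1) ω ≤ K} := by
  have hZm : Measurable fun ω j => Z j ω := measurable_pi_lambda _ hZ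
  have hsum : Measurable fun ω => ∑ i ∈ Finset.range N, Z (i + 1) ω :=
    Finset.measurable_fun_sum _ fun i _ => hZ _
  have h1m : Measurable ((Set.Iic K).indicator fun _ => (1 : ℝ≥0∞)) :=
    measurable_const.indicator measurableSet_Iic
  have h1 := lintegral_mul_eq_lintegral_mul_lintegral_of_indepFun''
    (hH.comp ((measurable_dropInterferers N).comp hZm)).aemeasurable (h1m.comp hsum).aemeasurable
    ((indepFun_dropInterferers hZ hind N).comp hH h1m)
  have h4 : ∫⁻ ω, ((Set.Iic K).indicator fun _ => (1 : ℝ≥0∞))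
      (∑ i ∈ Finset.range N, Z (i + 1) ω) ∂P = P {ω | ∑ i ∈ Finset.range N, Z (i + 1) ω ≤ K} :=
    lintegral_indicator_one (hsum measurableSet_Iic)
  rw [← h4, ← lintegral_comp_dropInterferers hZ hind hident N hH]
  refine Eq.trans (lintegral_congr fun ω => ?_) h1
  by_cases hω : ∑ i ∈ Finset.range N, Z (i + 1) ω ≤ K <;>
    simp [Set.indicator, hω]

end DropInterferers

/-! ### Positive probability of the bad event. -/

section BadEvent

variable {Ω : Type*} [MeasurableSpace Ω] {P : Measure Ω} [IsProbabilityMeasure P]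

/-- The process outside the ball of radius `b` and an independent variable are jointly independent
of the numbers of points inside the ball. -/
theorem setLIntegral_rankPoint {β : Type*} [MeasurableSpace β]
    {X : ℕ → Ω → Plane} (hX : ∀ j, Measurable (X j)) {μ : Measure Plane}
    (hPoisson : IsPoissonProcess P (fun ω => countingMeasure fun j => X j ω) μ)
    {Z : Ω → β} (hZ : Measurable Z) (hXZ : IndepFun (fun ω j => X j ω) Z P)
    {b : ℝ} {C D : Set Plane} (hC : MeasurableSet C) (hD : MeasurableSet D) (hCD : Disjoint C D)
    (hCb : C ⊆ Metric.ball 0 b) (hDb : D ⊆ Metric.ball 0 b) (N : ℝ≥0∞)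
    {H : (ℕ → Plane) × β → ℝ≥0∞} (hH : Measurable H) :
    ∫⁻ ω in {ω | countingMeasure (fun j => X j ω) C = N ∧ countingMeasure (fun j => X j ω) D = 0},
        H (rankPoint b (countingMeasure fun j => X j ω), Z ω) ∂P =
      P {ω | countingMeasure (fun j => X j ω) C = N ∧ countingMeasure (fun j => X j ω) D = 0} *
        ∫⁻ ω, ∫⁻ ω', H (rankPoint b (countingMeasure fun j => X j ω), Z ω') ∂P ∂P := by
  have hXm : Measurable fun ω j => X j ω := measurable_pi_lambda _ hX
  set E' : Set (Measure Plane) := {ν | ν C = N ∧ ν D = 0}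
  have hE' : MeasurableSet E' :=
    (Measure.measurable_coe hC (measurableSet_singleton N)).inter
      (Measure.measurable_coe hD (measurableSet_singleton 0))
  set E : Set Ω := {ω | countingMeasure (fun j => X j ω) C = N ∧
    countingMeasure (fun j => X j ω) D = 0} with hE
  have hEm : MeasurableSet E := (measurable_countingMeasure.comp hXm) hE'
  set ψ : (ℕ → Plane) → ℝ≥0∞ := fun x => ∫⁻ ω', H (x, Z ω') ∂P
  have hψ : Measurable ψ :=
    (hH.comp (measurable_fst.prodMk (hZ.comp measurable_snd))).lintegral_prod_right'
  have hcm : Measurable fun p : (ℕ → Plane) × β => countingMeasure p.1 :=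
    measurable_countingMeasure.comp measurable_fst
  have h1 := lintegral_comp_of_indepFun hXm hZ hXZ
    (H := fun p => E'.indicator (fun _ => (1 : ℝ≥0∞)) (countingMeasure p.1) *
      H (rankPoint b (countingMeasure p.1), p.2))
    (((measurable_const.indicator hE').comp hcm).mul
      (hH.comp (((measurable_rankPoint b).comp hcm).prodMk measurable_snd)))
  have hind : ∀ ω, E'.indicator (fun _ => (1 : ℝ≥0∞)) (countingMeasure fun j => X j ω) =
      E.indicator (fun _ => 1) ω := fun ω => rfl
  have hindmul : ∀ (G : Ω → ℝ≥0∞) ω, E.indicator G ω = E.indicator (fun _ => 1) ω * G ω := by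
    intro G ω
    by_cases hω : ω ∈ E <;> simp [hω]
  have hHZ : ∀ x, Measurable fun ω' => H (x, Z ω') := fun x =>
    hH.comp (measurable_const.prodMk hZ)
  simp only [hind] at h1
  have h2 : ∀ ω, ∫⁻ ω', E.indicator (fun _ => 1) ω *
      H (rankPoint b (countingMeasure fun j => X j ω), Z ω') ∂P =
      ψ (rankPoint b (countingMeasure fun j => X j ω)) * E.indicator (fun _ => 1) ω := fun ω => by
    rw [lintegral_const_mul _ (hHZ _), mul_comm]
  simp only [h2] at h1
  rw [← lintegral_indicator hEm]
  simp only [hindmul fun ω => H _]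
  rw [h1]
  -- `rankPoint b` is measurable with respect to the annulus counts, which are independent of the
  -- counts in `C` and `D`.
  have hindep := hPoisson.indep_annulus hC hD hCD hCb hDb
  have hρ : Measurable[⨆ (k : ℕ) (i : ℕ), MeasurableSpace.comap (fun ω =>
      countingMeasure (fun j => X j ω) (annulus b (i / 2 ^ k))) inferInstance]
      fun ω => rankPoint b (countingMeasure fun j => X j ω) :=
    @measurable_rankPoint_of_measurable Ω (_) b _ fun k i =>
      (comap_measurable _).mono (le_iSup₂_of_le k i le_rfl) le_rfl
  refine (lintegral_mul_indicator_eq_lintegral_mul_lintegral_indicator ?_ 1 hEm ?_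
    (hψ.comp hρ)).trans ?_
  rotate_left 2
  · rw [lintegral_indicator hEm, mul_comm]
    simp [ψ]
  · exact iSup₂_le fun k i =>
      (hPoisson.measurable_apply (measurableSet_annulus b _)).comap_le
  · refine indepSets_of_indepSets_of_le_right ((Indep_iff_IndepSets _ _ _).1 hindep) ?_
    rintro _ rfl
    exact ⟨{N} ×ˢ {0}, (measurableSet_singleton N).prod (measurableSet_singleton 0), rfl⟩

/-- Integrating over the positions first leaves an integrable function of the fading, restricted to
events that decrease to the empty set; dominated convergence applies. -/
theorem exists_lintegral_indicator_lt_le {Z : Ω → ℕ → ℝ≥0} (hZ : Measurable Z)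
    {ρ : Ω → ℕ → Plane} (hρ : Measurable ρ) {k : (ℕ → Plane) × (ℕ → ℝ≥0) → ℝ≥0∞}
    (hk : Measurable k) (hfin : ∫⁻ ω, ∫⁻ ω', k (ρ ω, Z ω') ∂P ∂P ≠ ∞) {e : ℝ≥0∞} (he : 0 < e) :
    ∃ M : ℕ, ∫⁻ ω, ∫⁻ ω', {z : ℕ → ℝ≥0 | (M : ℝ≥0) < z 0}.indicator
      (fun z => k (ρ ω, z)) (Z ω') ∂P ∂P ≤ e := by
  have hB : ∀ M : ℕ, MeasurableSet {z : ℕ → ℝ≥0 | (M : ℝ≥0) < z 0} := fun M =>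
    measurableSet_lt measurable_const (measurable_pi_apply 0)
  have hZ0 : ∀ M : ℕ, MeasurableSet {ω' | (M : ℝ≥0) < Z ω' 0} := fun M => hZ (hB M)
  have hjoint : Measurable fun p : Ω × Ω => k (ρ p.1, Z p.2) :=
    hk.comp ((hρ.comp measurable_fst).prodMk (hZ.comp measurable_snd))
  have hswap : ∀ M : ℕ, ∫⁻ ω, ∫⁻ ω', {z : ℕ → ℝ≥0 | (M : ℝ≥0) < z 0}.indicator
      (fun z => k (ρ ω, z)) (Z ω') ∂P ∂P =
      ∫⁻ ω', {ω' | (M : ℝ≥0) < Z ω' 0}.indicator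
        (fun ω' => ∫⁻ ω, k (ρ ω, Z ω') ∂P) ω' ∂P := fun M => by
    rw [lintegral_lintegral_swap]
    · refine lintegral_congr fun ω' => ?_
      by_cases hω' : (M : ℝ≥0) < Z ω' 0 <;> simp [Set.indicator, hω']
    · exact (hjoint.indicator (measurable_snd (hZ0 M))).aemeasurable
  have hkm : Measurable fun ω' => ∫⁻ ω, k (ρ ω, Z ω') ∂P := hjoint.lintegral_prod_left'
  have hkfin : ∫⁻ ω', ∫⁻ ω, k (ρ ω, Z ω') ∂P ∂P ≠ ∞ := by
    rwa [← lintegral_lintegral_swap (f := fun ω ω' => k (ρ ω, Z ω')) hjoint.aemeasurable]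
  have hlim := tendsto_lintegral_of_dominated_convergence (μ := P) (f := fun _ => 0)
    (F := fun (M : ℕ) => {ω' | (M : ℝ≥0) < Z ω' 0}.indicator
        fun ω' => ∫⁻ ω, k (ρ ω, Z ω') ∂P)
    (fun ω' => ∫⁻ ω, k (ρ ω, Z ω') ∂P) (fun M => hkm.indicator (hZ0 M))
    (fun M => ae_of_all _ fun ω' => Set.indicator_le_self _ _ _) hkfin (ae_of_all _ fun ω' => by
      obtain ⟨M₀, hM₀⟩ := exists_nat_ge (Z ω' 0)
      refine tendsto_atTop_of_eventually_const (i₀ := M₀) fun M hM => ?_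
      refine Set.indicator_of_notMem ?_ _
      simp only [Set.mem_ofPred_eq, not_lt]
      exact hM₀.trans (Nat.cast_le.2 hM))
  simp only [lintegral_zero] at hlim
  obtain ⟨M, hM⟩ := ((ENNReal.tendsto_nhds_zero.1 hlim) e he).exists
  exact ⟨M, (hswap M).trans_le hM⟩

/-- On the right only the last probability depends on `N`, so `M` and `K` can be fixed before `N`.
-/
theorem lintegral_add_indicators_dropInterferers {Z : ℕ → Ω → ℝ≥0} (hZ : ∀ j, Measurable (Z j))
    (hind : iIndepFun Z P) (hident : ∀ j, IdentDistrib (Z (j + 1)) (Z 1) P P)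
    {ρ : Ω → ℕ → Plane} (hρ : Measurable ρ) {k : (ℕ → Plane) × (ℕ → ℝ≥0) → ℝ≥0∞}
    (hk : Measurable k) (e : ℝ≥0∞) (M K : ℝ≥0) (N : ℕ) :
    ∫⁻ ω, ∫⁻ ω', (e +
        {z : ℕ → ℝ≥0 | M < z 0}.indicator
          (fun z => k (ρ ω, dropInterferers N z)) (fun j => Z j ω') +
        {z : ℕ → ℝ≥0 | ∑ i ∈ Finset.range N, z (i + 1) ≤ K}.indicator
          (fun z => k (ρ ω, dropInterferers N z)) (fun j => Z j ω')) ∂P ∂P =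
      e + ∫⁻ ω, ∫⁻ ω', {z : ℕ → ℝ≥0 | M < z 0}.indicator
          (fun z => k (ρ ω, z)) (fun j => Z j ω') ∂P ∂P +
        (∫⁻ ω, ∫⁻ ω', k (ρ ω, fun j => Z j ω') ∂P ∂P) *
          P {ω | ∑ i ∈ Finset.range N, Z (i + 1) ω ≤ K} := by
  have hZm : Measurable fun ω j => Z j ω := measurable_pi_lambda _ hZ
  have hB₁ : MeasurableSet {z : ℕ → ℝ≥0 | M < z 0} :=
    measurableSet_lt measurable_const (measurable_pi_apply 0)
  have hB₂ : MeasurableSet {z : ℕ → ℝ≥0 | ∑ i ∈ Finset.range N, z (i + 1) ≤ K} :=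
    measurableSet_le (Finset.measurable_fun_sum _ fun i _ => measurable_pi_apply (i + 1))
      measurable_const
  have hkx : ∀ x : ℕ → Plane, Measurable fun z => k (x, z) := fun x =>
    hk.comp measurable_prodMk_left
  have hdx : ∀ x : ℕ → Plane, Measurable fun z => k (x, dropInterferers N z) := fun x =>
    (hkx x).comp (measurable_dropInterferers N)
  have hm₁ : ∀ x : ℕ → Plane, Measurable fun ω' => {z : ℕ → ℝ≥0 | M < z 0}.indicator
      (fun z => k (x, dropInterferers N z)) (fun j => Z j ω') := fun x =>
    ((hdx x).indicator hB₁).comp hZm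
  have hm₂ : ∀ x : ℕ → Plane, Measurable fun ω' =>
      {z : ℕ → ℝ≥0 | ∑ i ∈ Finset.range N, z (i + 1) ≤ K}.indicator
      (fun z => k (x, dropInterferers N z)) (fun j => Z j ω') := fun x =>
    ((hdx x).indicator hB₂).comp hZm
  have hin : Measurable fun ω => ∫⁻ ω', k (ρ ω, fun j => Z j ω') ∂P :=
    (hk.comp ((hρ.comp measurable_fst).prodMk (hZm.comp measurable_snd))).lintegral_prod_right'
  have hsplit : ∀ ω, ∫⁻ ω', (e +
        {z : ℕ → ℝ≥0 | M < z 0}.indicator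
          (fun z => k (ρ ω, dropInterferers N z)) (fun j => Z j ω') +
        {z : ℕ → ℝ≥0 | ∑ i ∈ Finset.range N, z (i + 1) ≤ K}.indicator
          (fun z => k (ρ ω, dropInterferers N z)) (fun j => Z j ω')) ∂P =
      (e + ∫⁻ ω', {z : ℕ → ℝ≥0 | M < z 0}.indicator
          (fun z => k (ρ ω, z)) (fun j => Z j ω') ∂P) +
        (∫⁻ ω', k (ρ ω, fun j => Z j ω') ∂P) *
          P {ω | ∑ i ∈ Finset.range N, Z (i + 1) ω ≤ K} := fun ω => by
    rw [lintegral_add_right _ (hm₂ _), lintegral_add_right _ (hm₁ _), lintegral_const,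
      measure_univ, mul_one,
      lintegral_indicator_fading_dropInterferers hZ hind hident N (hkx (ρ ω)) M,
      lintegral_indicator_sum_dropInterferers hZ hind hident N (hkx (ρ ω)) K]
  rw [lintegral_congr hsplit, lintegral_add_right _ (hin.mul_const _),
    lintegral_add_left measurable_const, lintegral_mul_const _ hin]
  simp only [lintegral_const, measure_univ, mul_one]

theorem measurable_add_indicators_dropInterferers {k : (ℕ → Plane) × (ℕ → ℝ≥0) → ℝ≥0∞}
    (hk : Measurable k) (e : ℝ≥0∞) (M K : ℝ≥0) (N : ℕ) :
    Measurable fun p : (ℕ → Plane) × (ℕ → ℝ≥0) => e +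
      {z : ℕ → ℝ≥0 | M < z 0}.indicator (fun z => k (p.1, dropInterferers N z)) p.2 +
      {z : ℕ → ℝ≥0 | ∑ i ∈ Finset.range N, z (i + 1) ≤ K}.indicator
        (fun z => k (p.1, dropInterferers N z)) p.2 := by
  have hB₁ : MeasurableSet {z : ℕ → ℝ≥0 | M < z 0} :=
    measurableSet_lt measurable_const (measurable_pi_apply 0)
  have hB₂ : MeasurableSet {z : ℕ → ℝ≥0 | ∑ i ∈ Finset.range N, z (i + 1) ≤ K} :=
    measurableSet_le (Finset.measurable_fun_sum _ fun i _ => measurable_pi_apply (i + 1))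
      measurable_const
  have hkd : Measurable fun p : (ℕ → Plane) × (ℕ → ℝ≥0) => k (p.1, dropInterferers N p.2) :=
    hk.comp (measurable_fst.prodMk ((measurable_dropInterferers N).comp measurable_snd))
  exact (measurable_const.add (hkd.indicator (measurable_snd hB₁))).add
    (hkd.indicator (measurable_snd hB₂))

theorem measure_badEvent_pos
    {X : ℕ → Ω → Plane} (hX : ∀ j, Measurable (X j))
    (hXord : ∀ᵐ ω ∂P, Monotone fun j => ‖X j ω‖) {Λ : ℝ≥0} (hΛ : 0 < Λ)
    (hPoisson : IsPoissonProcess P (fun ω => countingMeasure fun j => X j ω) (Λ • volume))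
    {F : ℕ → ℝ → Ω → ℝ≥0} (hF : ∀ j t, Measurable (F j t))
    (hFindep : iIndepFun (fun j ω t => F j t ω) P)
    (hFident : ∀ j, IdentDistrib (F (j + 1) 0) (F 1 0) P P)
    (hFnz : ¬ ∀ᵐ ω ∂P, F 1 0 ω = 0)
    (hXF : IndepFun (fun ω j => X j ω) (fun ω j t => F j t ω) P)
    {l : ℝ → ℝ≥0} (hl : Measurable l)
    (hlnz : ¬ ∀ᵐ r ∂(volume.restrict (Set.Ioi (0 : ℝ))), l r = 0) {R : ℝ} {γ : ℝ≥0}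
    {g h : ℝ≥0∞ → ℝ≥0∞} (hgc : Tendsto g (𝓝 0) (𝓝 0)) (hmono : Monotone h)
    (hgh : ∀ x, g x ≤ h x)
    (hfin : ∫⁻ ω, h (sinr l R γ (fun j => X j ω) fun j => F j 0 ω) ∂P < ∞)
    {δ : ℝ} (hδ : 0 < δ) {lam : ℝ≥0} (hlam : 0 < lam) :
    0 < P (badEvent P X (serviceRate g l R γ X F) δ lam) := by
  have hXm : Measurable fun ω j => X j ω := measurable_pi_lambda _ hX
  set Z : Ω → ℕ → ℝ≥0 := fun ω j => F j 0 ω with hZdef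
  have hZj : ∀ j, Measurable (F j 0) := fun j => hF j 0
  have hZ : Measurable Z := measurable_pi_lambda _ hZj
  have hXZ : IndepFun (fun ω j => X j ω) Z P := by
    refine hXF.comp measurable_id (ψ := fun z j => z j 0) ?_
    exact measurable_pi_lambda _ fun j => (measurable_pi_apply _).comp (measurable_pi_apply j)
  have hZind : iIndepFun (fun j => F j 0) P :=
    hFindep.comp (fun _ z => z 0) fun _ => measurable_pi_apply 0
  have hh : Measurable h := hmono.measurable
  have hhs : Measurable fun p : (ℕ → Plane) × (ℕ → ℝ≥0) => h (sinr l R γ p.1 p.2) :=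
    hh.comp (measurable_sinr hl R γ)
  obtain ⟨b, ε, S, hb, hε, hS, hSb, hεl, hSvol⟩ := exists_measurableSet_pathLoss_ge hl hlnz
  set C : Set Plane := {y | ‖y‖ ∈ S} with hCdef
  set D : Set Plane := Metric.ball 0 b \ C with hDdef
  have hC : MeasurableSet C := measurable_norm hS
  have hD : MeasurableSet D := measurableSet_ball.diff hC
  have hCD : Disjoint C D := Set.disjoint_sdiff_right
  have hCb : C ⊆ Metric.ball 0 b := fun y hy => mem_ball_zero_iff.2 (hSb hy).2
  have hDb : D ⊆ Metric.ball 0 b := Set.sdiff_subset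
  have hCvol : (volume : Measure Plane) C ≠ 0 := volume_setOf_norm_mem_ne_zero hS hSb hSvol
  have hCfin : (volume : Measure Plane) C ≠ ∞ :=
    ((measure_mono hCb).trans_lt measure_ball_lt_top).ne
  set E : ℕ → Set Ω := fun N => {ω | countingMeasure (fun j => X j ω) C = N ∧
    countingMeasure (fun j => X j ω) D = 0} with hEdef
  have hEpos : ∀ N, P (E N) ≠ 0 := fun N => hPoisson.measure_pos hC hD hCD
    (Metric.isBounded_ball.subset hCb) (Metric.isBounded_ball.subset hDb)
    (by simp [hCvol, hΛ.ne']) (by simpa using ENNReal.mul_ne_top ENNReal.coe_ne_top hCfin) N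
  set ρ : Ω → ℕ → Plane := fun ω => rankPoint b (countingMeasure fun j => X j ω)
  have hρ : Measurable ρ := (measurable_rankPoint b).comp (measurable_countingMeasure.comp hXm)
  have hfactor : ∀ (N : ℕ) {H : (ℕ → Plane) × (ℕ → ℝ≥0) → ℝ≥0∞}, Measurable H →
      ∫⁻ ω in E N, H (ρ ω, Z ω) ∂P = P (E N) * ∫⁻ ω, ∫⁻ ω', H (ρ ω, Z ω') ∂P ∂P :=
    fun N H hH => setLIntegral_rankPoint hX hPoisson hZ hXZ hC hD hCD hCb hDb N hH
  have hEm : ∀ N, MeasurableSet (E N) := fun N =>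
    (hPoisson.measurable_apply hC (measurableSet_singleton _)).inter
      (hPoisson.measurable_apply hD (measurableSet_singleton _))
  -- the configuration on `E N`
  have hconf : ∀ N, ∀ᵐ ω ∂P, ω ∈ E N → (∀ i < N, ε ≤ l ‖X i ω‖) ∧
      ∀ j, ‖ρ ω j‖ = ‖X (N + j) ω‖ := by
    intro N
    filter_upwards [hXord] with ω hω hE
    have hball : countingMeasure (fun j => X j ω) (Metric.ball 0 b) = N := by
      rw [← Set.union_sdiff_cancel hCb, measure_union hCD hD, hE.1, hE.2, add_zero]
    have hlt := norm_lt_iff_of_countingMeasure_ball hω hball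
    refine ⟨fun i hi => hεl _ ?_, fun j => norm_rankPoint hω hb.le (fun i hi => (hlt i).2 hi)
      (fun i hi => not_lt.1 fun h => absurd ((hlt i).1 h) (not_lt.2 hi)) j⟩
    by_contra hc
    have h0 := hE.2
    rw [countingMeasure_apply _ hD, Measure.count_eq_zero_iff] at h0
    exact absurd (show i ∈ {i | X i ω ∈ D} from ⟨mem_ball_zero_iff.2 ((hlt i).2 hi), hc⟩)
      (by rw [h0]; exact Set.notMem_empty i)
  set I := ∫⁻ ω, ∫⁻ ω', h (sinr l R γ (ρ ω) (Z ω')) ∂P ∂P with hI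
  -- On `E 0` the ball is empty and the far field is the whole field. Since `P (E 0) > 0` and `E 0`
  -- is independent of the far field, an infinite `I` would contradict integrability of `h` of the
  -- SINR.
  have hIfin : I ≠ ∞ := by
    have h1 := hfactor 0 hhs
    have h2 : ∫⁻ ω in E 0, h (sinr l R γ (ρ ω) (Z ω)) ∂P ≤
        ∫⁻ ω, h (sinr l R γ (fun j => X j ω) (Z ω)) ∂P := by
      refine le_trans (le_of_eq ?_) (setLIntegral_le_lintegral (E 0) _)
      refine setLIntegral_congr_fun_ae (hEm 0) ?_
      filter_upwards [hconf 0] with ω hω hE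
      rw [sinr_congr_norm fun j => by simpa using (hω hE).2 j]
    intro hI0
    simp only at h1
    rw [h1, ← hI, hI0, ENNReal.mul_top (hEpos 0)] at h2
    exact absurd (h2.trans_lt hfin) (lt_irrefl _)
  -- the constants
  set e : ℝ≥0∞ := ENNReal.ofReal (lam / (4 * δ)) with he
  have hlam' : (0 : ℝ) < lam := hlam
  have he0 : 0 < e := ENNReal.ofReal_pos.2 (by positivity)
  -- Three error terms will appear; the factor `4` leaves a total of `3 / 4 * lam`.
  have he3 : ENNReal.ofReal δ * (e + e + e) < lam := by
    rw [he, ← ENNReal.ofReal_add (by positivity) (by positivity),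
      ← ENNReal.ofReal_add (by positivity) (by positivity), ← ENNReal.ofReal_mul hδ.le,
      ← ENNReal.ofReal_coe_nnreal, ENNReal.ofReal_lt_ofReal_iff hlam']
    have : δ * (lam / (4 * δ) + lam / (4 * δ) + lam / (4 * δ)) = 3 / 4 * lam := by
      field_simp; ring
    rw [this]
    linarith
  obtain ⟨M, hM⟩ := exists_lintegral_indicator_lt_le hZ hρ hhs hIfin he0
  obtain ⟨θ, hθ0, hθ⟩ : ∃ θ : ℝ≥0, 0 < θ ∧ ∀ u ≤ (θ : ℝ≥0∞), g u ≤ e := by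
    obtain ⟨θ, hθ0, hθ⟩ := (ENNReal.nhds_zero_basis_Iic.eventually_iff).1
      ((ENNReal.tendsto_nhds_zero.1 hgc) e he0)
    -- The threshold obtained in `[0, ∞]` may be infinite; `min θ 1` makes it finite.
    refine ⟨(min θ 1).toNNReal, ENNReal.toNNReal_pos (by simp [hθ0.ne'])
      (by simp), fun u hu => hθ ?_⟩
    rw [ENNReal.coe_toNNReal (by simp)] at hu
    exact hu.trans (min_le_left _ _)
  set K : ℝ≥0 := l R * M / (ε * θ) with hK
  have hKθ : θ * (ε * K) = l R * M := by
    rw [hK]; field_simp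
  obtain ⟨N, hN⟩ : ∃ N : ℕ, I * P {ω | ∑ i ∈ Finset.range N, F (i + 1) 0 ω ≤ K} ≤ e := by
    have hsucc : Function.Injective fun j : ℕ => j + 1 := fun i j hij => by simpa using hij
    have h1 := tendsto_measure_sum_le (P := P) (W := fun j => F (j + 1) 0) (fun j => hZj _)
      (hZind.precomp hsucc) hFident hFnz K
    have h2 := ENNReal.Tendsto.const_mul h1 (a := I) (Or.inr hIfin)
    rw [mul_zero] at h2
    exact ((ENNReal.tendsto_nhds_zero.1 h2) e he0).exists
  have hbound : ∫⁻ ω in E N, serviceRate g l R γ X F 0 ω ∂P ≤ ∫⁻ ω in E N, (e +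
      {z : ℕ → ℝ≥0 | (M : ℝ≥0) < z 0}.indicator
        (fun z => h (sinr l R γ (ρ ω) (dropInterferers N z))) (Z ω) +
      {z : ℕ → ℝ≥0 | ∑ i ∈ Finset.range N, z (i + 1) ≤ K}.indicator
        (fun z => h (sinr l R γ (ρ ω) (dropInterferers N z))) (Z ω)) ∂P := by
    refine setLIntegral_mono_ae' (hEm N) ?_
    filter_upwards [hconf N] with ω hω hE
    exact rate_le_add_indicators (x := fun j => X j ω) (y := ρ ω) hmono hgh (hω hE).2 (hω hE).1
      hθ hKθ (Z ω)
  have hEN : ∫⁻ ω in E N, serviceRate g l R γ X F 0 ω ∂P ≤ P (E N) * (e + e + e) := by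
    refine hbound.trans ((hfactor N
      (measurable_add_indicators_dropInterferers hhs e M K N)).trans_le ?_)
    refine mul_le_mul_right ((lintegral_add_indicators_dropInterferers hZj hZind hFident hρ hhs
      e M K N).trans_le ?_) _
    exact add_le_add (add_le_add le_rfl hM) hN
  -- comparison with the conditional expectation
  by_contra hbad
  have hbad0 : P (badEvent P X (serviceRate g l R γ X F) δ lam) = 0 := by simpa using hbad
  have hΦ := hPoisson.measurable
  -- `E N` is determined by `Φ`, so the rate and its conditional expectation have the same integral
  -- over it.
  have hcond := setLIntegral_condLExp hΦ.comap_le P (serviceRate g l R γ X F 0) (s := E N)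
    ⟨{ν | ν C = N ∧ ν D = 0}, (Measure.measurable_coe hC (measurableSet_singleton _)).inter
      (Measure.measurable_coe hD (measurableSet_singleton _)), rfl⟩
  have hge : ∀ᵐ ω ∂P, (lam : ℝ≥0∞) ≤ ENNReal.ofReal δ * (P⁻[serviceRate g l R γ X F 0 |
      MeasurableSpace.comap (fun ω' => countingMeasure fun j => X j ω') inferInstance]) ω := by
    filter_upwards [measure_eq_zero_iff_ae_notMem.1 hbad0] with ω hω
    exact not_lt.1 hω
  have hcontra : (lam : ℝ≥0∞) * P (E N) ≤ ENNReal.ofReal δ * (e + e + e) * P (E N) := by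
    calc (lam : ℝ≥0∞) * P (E N) = ∫⁻ _ in E N, (lam : ℝ≥0∞) ∂P := by simp
      _ ≤ ∫⁻ ω in E N, ENNReal.ofReal δ * (P⁻[serviceRate g l R γ X F 0 |
          MeasurableSpace.comap (fun ω' => countingMeasure fun j => X j ω') inferInstance]) ω ∂P :=
        lintegral_mono_ae (ae_restrict_of_ae hge)
      _ = ENNReal.ofReal δ * ∫⁻ ω in E N, serviceRate g l R γ X F 0 ω ∂P := by
        rw [lintegral_const_mul' _ _ ENNReal.ofReal_ne_top, hcond]
      _ ≤ ENNReal.ofReal δ * (P (E N) * (e + e + e)) := by gcongr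
      _ = _ := by ring
  rw [ENNReal.mul_le_mul_iff_left (hEpos N) (measure_ne_top _ _)] at hcontra
  exact absurd hcontra (not_le.2 he3)

end BadEvent

end StaticField

/-! ### The theorem. -/

open StaticField in
theorem mainTheorem5 {Ω : Type*} [MeasurableSpace Ω] (P : Measure Ω) [IsProbabilityMeasure P]
    -- the static Poisson field, its points listed by increasing distance from the origin
    (X : ℕ → Ω → Plane) (hX : ∀ j, Measurable (X j))
    (hXord : ∀ᵐ ω ∂P, Monotone fun j => ‖X j ω‖)
    (Λ : ℝ≥0) (hΛ : 0 < Λ)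
    (hPoisson : IsPoissonProcess P (fun ω => countingMeasure fun j => X j ω) (Λ • volume))
    -- fading processes: index `0` for the useful signal, index `j + 1` for the `j`-th interferer
    (F : ℕ → ℝ → Ω → ℝ≥0) (hF : ∀ j t, Measurable (F j t))
    (hFcont : ∀ j ω, Continuous fun t => F j t ω)
    (hFstat : ∀ j, IsStationary P (F j)) (hFmix : ∀ j, IsStronglyMixing P (F j))
    (hFindep : iIndepFun (fun j ω t => F j t ω) P)
    (hFident : ∀ j, IdentDistrib (F (j + 1) 0) (F 1 0) P P)
    (hFnz : ¬ ∀ᵐ ω ∂P, F 1 0 ω = 0)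
    (hXF : IndepFun (fun ω j => X j ω) (fun ω j t => F j t ω) P)
    -- path loss, distance to the transmitter, thermal noise
    (l : ℝ → ℝ≥0) (hl : Measurable l) (hlnz : ¬ ∀ᵐ r ∂(volume.restrict (Set.Ioi (0 : ℝ))), l r = 0)
    (R : ℝ) (hR : 0 < R) (γ : ℝ≥0)
    -- service rate as a function of the SINR
    (g : ℝ≥0∞ → ℝ≥0∞) (hg : Measurable g) (hg0 : g 0 = 0) (hgc : Tendsto g (𝓝 0) (𝓝 0))
    (hgdom : ∃ h : ℝ≥0∞ → ℝ≥0∞, Monotone h ∧ (∀ x, g x ≤ h x) ∧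
      ∫⁻ ω, h (sinr l R γ (fun j => X j ω) (fun j => F j 0 ω)) ∂P < ∞)
    -- arrivals
    (δ : ℝ) (hδ : 0 < δ)
    (A : ℤ → Ω → ℝ≥0) (hA : ∀ n, Measurable (A n)) (hAerg : IsStationaryErgodic P A)
    (hAindep : IndepFun (fun ω n => A n ω)
      (fun ω => ((fun j => X j ω : ℕ → Plane), (fun j t => F j t ω : ℕ → ℝ → ℝ≥0))) P)
    (lam : ℝ≥0) (hlam : 0 < lam) (hrate : ∫⁻ ω, A 0 ω ∂P = lam) :
    0 < P (badEvent P X (serviceRate g l R γ X F) δ lam) ∧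
    (∀ᵐ ω ∂P, ω ∈ badEvent P X (serviceRate g l R γ X F) δ lam →
      ∀ n : ℤ, stationaryWorkload (fun k => (A k ω : ℝ≥0∞))
        (fun k => slotService δ (serviceRate g l R γ X F) k ω) n = ∞) ∧
    0 < P {ω | ∀ n : ℤ, stationaryWorkload (fun k => (A k ω : ℝ≥0∞))
        (fun k => slotService δ (serviceRate g l R γ X F) k ω) n = ∞} := by
  obtain ⟨h, hmono, hgh, hfin⟩ := hgdom
  have hpos := measure_badEvent_pos hX hXord hΛ hPoisson hF hFindep hFident hFnz hXF hl hlnz hgc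
    hmono hgh hfin hδ hlam
  have hfin' : ∫⁻ ω, g (sinr l R γ (fun j => X j ω) fun j => F j 0 ω) ∂P ≠ ∞ :=
    ((lintegral_mono fun ω => hgh _).trans_lt hfin).ne
  have hbad := ae_stationaryWorkload_eq_top hX hXord hF hFcont hFstat hFmix hFindep hXF hl hg
    hfin' hδ hA hAerg hrate
  exact ⟨hpos, hbad, hpos.trans_le (measure_mono_ae hbad)⟩
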